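/- Let $\lambda>-1/2$ and $r\in\mathbb{Z}_+=\{0,1,2,\dots\}$. For $\mu>-1$ let $j_\mu$ be the normalized Bessel function $$j_\mu(x)=\Gamma(\mu+1)\sum_{k=0}^\infty\frac{(-1)^k}{k!\,\Gamma(\mu+k+1)}\Bigl(\frac x2\Bigr)^{2k},\qquad x\in\mathbb{R},$$ so that $j_\mu(x)=2^\mu\Gamma(\mu+1)x^{-\mu}J_\mu(x)$ for $x>0$, where $J_\mu$ is the Bessel function of the first kind. Put $$e_{2r+1}(v,\lambda)=j_\lambda(v)+i(-1)^{r+1}\frac{v^{2r+1}}{2^{2r+1}(\lambda+1)_{2r+1}}\,j_{\lambda+2r+1}(v),\qquad (a)_n=a(a+1)\cdots(a+n-1),$$ and, for complex-valued functions $g$ on $\mathbb{R}$, $$\mathcal{F}_r^\lambda(g)(v)=\int_{-\infty}^\infty e_{2r+1}(uv,\lambda)\,g(u)\,\frac{|u|^{2\lambda+1}\,du}{2^{\lambda+1}\Gamma(\lambda+1)},\qquad v\in\mathbb{R}.$$ Let $\mathcal{S}_r(\mathbb{R})$ be the set of complex-valued Schwartz functions $g$ on $\mathbb{R}$ with $g^{(2s+1)}(0)=0$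 for $s=0,1,\dots,r-1$; thus $\mathcal{S}_0(\mathbb{R})=\mathcal{S}(\mathbb{R})$. Then for $g\in\mathcal{S}_r(\mathbb{R})$ the integral defining $\mathcal{F}_r^\lambda(g)(v)$ converges absolutely for every $v\in\mathbb{R}$, and $$\mathcal{F}_r^\lambda(\mathcal{S}_r(\mathbb{R}))=\mathcal{S}_r(\mathbb{R}).$$ In particular $\mathcal{F}_0^\lambda(\mathcal{S}(\mathbb{R}))=\mathcal{S}(\mathbb{R})$, and $\mathcal{F}_0^\lambda$ is the one-dimensional Dunkl transform with parameter $\kappa=\lambda+\frac12$: its kernel $(u,v)\mapsto e_1(uv,\lambda)$ is the unique function $E(u,v)$ on $\mathbb{R}^2$ such that for every $v$ the function $f=E(\cdot,v)$ is smooth, $f(0)=1$, and $$f'(u)+\kappa\,\frac{f(u)-f(-u)}{u}=-iv\,f(u),\qquad u\in\mathbb{R},$$ where the quotient is read as its limit $2f'(0)$ at $u=0$. -/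

import Mathlib

open MeasureTheory
open scoped SchwartzMap ContDiff

noncomputable section

/-- The classical Bessel function of the first kind `J_μ(x)`, for `x > 0`. -/
def besselJ (μ x : ℝ) : ℝ :=
  ∑' k : ℕ, (-1) ^ k / ((k.factorial : ℝ) * Real.Gamma (μ + k + 1)) * (x / 2) ^ (2 * (k : ℝ) + μ)

/-- The normalized Bessel function `j_μ`, an even function on the whole real line with `j_μ(0) = 1`.
For `x > 0` it is `2 ^ μ * Γ(μ + 1) * x ^ (-μ) * J_μ(x)`, see `normBessel_eq_besselJ`. -/
def normBessel (μ x : ℝ) : ℝ :=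
  Real.Gamma (μ + 1) *
    ∑' k : ℕ, (-1) ^ k / ((k.factorial : ℝ) * Real.Gamma (μ + k + 1)) * (x / 2) ^ (2 * k)

theorem normBessel_eq_besselJ (μ x : ℝ) (hx : 0 < x) :
    normBessel μ x = 2 ^ μ * Real.Gamma (μ + 1) * x ^ (-μ) * besselJ μ x := by
  have h2 : (2 : ℝ) ^ μ * x ^ (-μ) * (x / 2) ^ μ = 1 := by
    rw [Real.div_rpow hx.le (by norm_num), Real.rpow_neg hx.le]
    have h3 : (0 : ℝ) < 2 ^ μ := Real.rpow_pos_of_pos (by norm_num) _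
    have h4 : (0 : ℝ) < x ^ μ := Real.rpow_pos_of_pos hx _
    field_simp
  have h1 : besselJ μ x = (x / 2) ^ μ *
      ∑' k : ℕ, (-1) ^ k / ((k.factorial : ℝ) * Real.Gamma (μ + k + 1)) * (x / 2) ^ (2 * k) := by
    rw [besselJ, ← tsum_mul_left]
    refine tsum_congr fun k => ?_
    rw [Real.rpow_add (by positivity), show (2 * (k : ℝ)) = ((2 * k : ℕ) : ℝ) by push_cast; ring,
      Real.rpow_natCast]
    ring
  rw [h1, normBessel]
  linear_combination (-(Real.Gamma (μ + 1) *
    ∑' k : ℕ, (-1) ^ k / ((k.factorial : ℝ) * Real.Gamma (μ + k + 1)) * (x / 2) ^ (2 * k))) * h2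

/-- The function `e_{2r+1}(v, lam)`; the factor `(lam+1)_{2r+1}` is a Pochhammer symbol. -/
def oddKernel (r : ℕ) (lam v : ℝ) : ℂ :=
  (normBessel lam v : ℂ) + Complex.I * (-1) ^ (r + 1) *
    ((v ^ (2 * r + 1) / (2 ^ (2 * r + 1) * (ascPochhammer ℝ (2 * r + 1)).eval (lam + 1)) *
      normBessel (lam + (2 * r + 1)) v : ℝ) : ℂ)

/-- The density of the measure `|u| ^ (2 lam + 1) du / (2 ^ (lam + 1) Γ(lam + 1))`. -/
def nuDensity (lam u : ℝ) : ℝ :=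
  |u| ^ (2 * lam + 1) / (2 ^ (lam + 1) * Real.Gamma (lam + 1))

/-- The non-deformed transform `F_r^lam`. -/
def nonDeformedTransform (r : ℕ) (lam : ℝ) (g : ℝ → ℂ) (v : ℝ) : ℂ :=
  ∫ u : ℝ, oddKernel r lam (u * v) * g u * (nuDensity lam u : ℂ)

/-- The Schwartz space, as a set of complex-valued functions on the real line. -/
def schwartzFunctions : Set (ℝ → ℂ) := Set.range fun g : 𝓢(ℝ, ℂ) => (g : ℝ → ℂ)

/-- The space `S_r`: Schwartz functions whose derivatives of orders `1, 3, …, 2r - 1` vanish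
at `0`. -/
def schwartzOddVanishing (r : ℕ) : Set (ℝ → ℂ) :=
  {g | g ∈ schwartzFunctions ∧ ∀ s < r, iteratedDeriv (2 * s + 1) g 0 = 0}

/-- The one-dimensional Dunkl operator `T_k f(u) = f'(u) + k (f(u) - f(-u)) / u`, the quotient
being replaced by its limit `2 f'(0)` at `u = 0`. -/
def dunklOperator (k : ℝ) (f : ℝ → ℂ) (u : ℝ) : ℂ :=
  deriv f u + k * (if u = 0 then 2 * deriv f 0 else (f u - f (-u)) / u)

/-- `E` is the kernel `E(u, v) = E_k(u, -iv)` of the one-dimensional Dunkl transform: for each `v`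
the function `E(·, v)` is a smooth solution of `T_k f = -iv f` with `f(0) = 1`. -/
structure IsDunklKernel (k : ℝ) (E : ℝ → ℝ → ℂ) : Prop where
  smooth : ∀ v, ContDiff ℝ ∞ fun u => E u v
  eigen : ∀ u v, dunklOperator k (fun u' => E u' v) u = -Complex.I * v * E u v
  at_zero : ∀ v, E 0 v = 1

end

/-! Everything reduces to the Hankel transform H_μ with kernel j_μ. A member of S_r is f(u) +
u^(2r+1) h(u) with f, h even Schwartz functions (`mem_schwartzOddVanishing_iff`). Against the kernel
e_{2r+1} the cross terms are odd and integrate to zero, while u^(2(2r+1)) shifts the weight from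
index λ to λ+2r+1. So the transform sends (f, h) to (H_λ f, i(-1)^(r+1) H_{λ+2r+1} h)
(`nonDeformedTransform_eq`), and it is enough that H_μ preserves the even Schwartz functions and is
an involution on them.

Preservation rests on index shifts: d/dv H_μ f = -v H_{μ+1} f, together with integrations by parts
that turn v² H_μ f into H_μ of a Bessel operator applied to f. Derivatives and decay are thus
controlled within the family of all H_μ, μ > -1/2.

For the involution, H_μ H_μ commutes with multiplication by u² and fixes the Gaussian. Given a point
a, subtracting a multiple of the Gaussian makes f vanish at a, and Hadamard division gives a
remainder (u² - a²) q, whose image under H_μ H_μ vanishes at a.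

An energy estimate for the Dunkl equation gives both the boundedness of j_μ and the uniqueness of
the Dunkl kernel. -/

/-! ### Normalized Bessel functions: series, recurrence, smoothness -/

/-- Each use of the functional equation divides by a factor exceeding 1/2. This gives a domination
of the Bessel series that is uniform in μ. -/
theorem gamma_div_gamma_add_le {μ : ℝ} (hμ : -(1 / 2) < μ) (k : ℕ) :
    Real.Gamma (μ + 1) / Real.Gamma (μ + k + 1) ≤ 2 ^ k := by
  have hpos : ∀ n : ℕ, 0 < Real.Gamma (μ + n + 1) := fun n =>
    Real.Gamma_pos_of_pos (by have : (0 : ℝ) ≤ n := n.cast_nonneg; linarith)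
  rw [div_le_iff₀ (hpos k)]
  induction k with
  | zero => simp
  | succ k ih =>
    have hk : (0 : ℝ) ≤ k := k.cast_nonneg
    have h1 : Real.Gamma (μ + (k + 1 : ℕ) + 1) = (μ + k + 1) * Real.Gamma (μ + k + 1) := by
      rw [← Real.Gamma_add_one (by linarith)]; push_cast; ring_nf
    rw [h1]
    calc Real.Gamma (μ + 1) ≤ 2 ^ k * Real.Gamma (μ + k + 1) := ih
      _ = 2 ^ (k + 1) * (1 / 2 * Real.Gamma (μ + k + 1)) := by ring
      _ ≤ _ := by
        gcongr
        · exact (hpos k).le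
        · linarith

/-- The terms of the power series of `normBessel μ x`. -/
noncomputable def besselTerm (μ : ℝ) (k : ℕ) (x : ℝ) : ℝ :=
  Real.Gamma (μ + 1) *
    ((-1) ^ k / ((k.factorial : ℝ) * Real.Gamma (μ + k + 1)) * (x / 2) ^ (2 * k))

theorem normBessel_eq_tsum (μ x : ℝ) : normBessel μ x = ∑' k, besselTerm μ k x := by
  simp only [normBessel, besselTerm, tsum_mul_left]

theorem abs_besselTerm_le {μ : ℝ} (hμ : -(1 / 2) < μ) (k : ℕ) (x : ℝ) :
    |besselTerm μ k x| ≤ (x ^ 2 / 2) ^ k / k.factorial := by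
  have hk : (0 : ℝ) ≤ k := k.cast_nonneg
  have h1 : 0 < Real.Gamma (μ + k + 1) := Real.Gamma_pos_of_pos (by linarith)
  have h2 : 0 < Real.Gamma (μ + 1) := Real.Gamma_pos_of_pos (by linarith)
  have h3 : |besselTerm μ k x| =
      Real.Gamma (μ + 1) / Real.Gamma (μ + k + 1) * ((x ^ 2 / 4) ^ k / k.factorial) := by
    have h4 : (x / 2) ^ (2 * k) = (x ^ 2 / 4) ^ k := by rw [pow_mul]; ring
    have h5 : 0 ≤ (x ^ 2 / 4) ^ k := by positivity
    rw [besselTerm, h4, abs_mul, abs_mul, abs_div, abs_pow, abs_neg, abs_one, one_pow,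
      abs_of_pos h2, abs_of_nonneg h5, abs_of_pos (by positivity)]
    field_simp
  rw [h3]
  calc _ ≤ 2 ^ k * ((x ^ 2 / 4) ^ k / k.factorial) := by
        gcongr
        exact gamma_div_gamma_add_le hμ k
    _ = (x ^ 2 / 2) ^ k / k.factorial := by
        rw [← mul_div_assoc, ← mul_pow]; ring

theorem summable_besselTerm {μ : ℝ} (hμ : -(1 / 2) < μ) (x : ℝ) :
    Summable fun k => besselTerm μ k x :=
  .of_norm_bounded (Real.summable_pow_div_factorial (x ^ 2 / 2)) fun k =>
    abs_besselTerm_le hμ k x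

theorem besselTerm_zero {μ : ℝ} (hμ : -(1 / 2) < μ) (x : ℝ) : besselTerm μ 0 x = 1 := by
  have h2 : 0 < Real.Gamma (μ + 1) := Real.Gamma_pos_of_pos (by linarith)
  simp [besselTerm, h2.ne']

theorem hasDerivAt_besselTerm_succ {μ : ℝ} (hμ : -(1 / 2) < μ) (k : ℕ) (x : ℝ) :
    HasDerivAt (besselTerm μ (k + 1)) (-(x / (2 * (μ + 1))) * besselTerm (μ + 1) k x) x := by
  have hk : (0 : ℝ) ≤ k := k.cast_nonneg
  have h1 : 0 < Real.Gamma (μ + 1 + k + 1) := Real.Gamma_pos_of_pos (by linarith)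
  have h2 : 0 < μ + 1 := by linarith
  have h3 : μ + (k + 1 : ℕ) + 1 = μ + 1 + k + 1 := by push_cast; ring
  have hd := ((((hasDerivAt_id x).div_const 2).pow (2 * (k + 1))).const_mul
    ((-1) ^ (k + 1) / (((k + 1).factorial : ℝ) * Real.Gamma (μ + (k + 1 : ℕ) + 1)))).const_mul
      (Real.Gamma (μ + 1))
  refine hd.congr_deriv ?_
  rw [besselTerm, Real.Gamma_add_one h2.ne', h3, Nat.factorial_succ,
    show 2 * (k + 1) - 1 = 2 * k + 1 by omega]
  simp only [id]
  push_cast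
  field_simp
  ring

/-- The two terms of order k+1 have ratio (μ+1)/(μ+k+2), so their difference carries a factor k+1;
this cancels against the factorial and leaves a term of order k. -/
theorem besselTerm_succ_sub {μ : ℝ} (hμ : -(1 / 2) < μ) (k : ℕ) (x : ℝ) :
    besselTerm μ (k + 1) x = besselTerm (μ + 1) (k + 1) x -
      x ^ 2 / (4 * (μ + 1) * (μ + 2)) * besselTerm (μ + 2) k x := by
  have hk : (0 : ℝ) ≤ k := k.cast_nonneg
  have h2 : 0 < μ + 1 := by linarith
  have h2' : 0 < μ + 1 + 1 := by linarith
  have h4 : 0 < μ + k + 1 + 1 := by linarith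
  have h1 : 0 < Real.Gamma (μ + k + 1 + 1) := Real.Gamma_pos_of_pos (by linarith)
  rw [besselTerm, besselTerm, besselTerm, Nat.factorial_succ,
    show μ + (k + 1 : ℕ) + 1 = μ + k + 1 + 1 by push_cast; ring,
    show μ + 1 + (k + 1 : ℕ) + 1 = μ + k + 1 + 1 + 1 by push_cast; ring,
    show μ + 2 + k + 1 = μ + k + 1 + 1 + 1 by ring, show μ + 2 = μ + 1 + 1 by ring,
    Real.Gamma_add_one h2'.ne', Real.Gamma_add_one h2.ne', Real.Gamma_add_one h4.ne']
  push_cast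
  field_simp
  ring

theorem normBessel_recurrence {μ : ℝ} (hμ : -(1 / 2) < μ) (x : ℝ) :
    normBessel μ x = normBessel (μ + 1) x -
      x ^ 2 / (4 * (μ + 1) * (μ + 2)) * normBessel (μ + 2) x := by
  have h1 := summable_besselTerm hμ x
  have h2 := summable_besselTerm (μ := μ + 1) (by linarith) x
  have h3 := summable_besselTerm (μ := μ + 2) (by linarith) x
  simp only [normBessel_eq_tsum]
  rw [h1.tsum_eq_zero_add, h2.tsum_eq_zero_add, besselTerm_zero hμ,
    besselTerm_zero (by linarith), ← tsum_mul_left, add_sub_assoc,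
    ← ((summable_nat_add_iff 1).2 h2).tsum_sub (h3.mul_left _)]
  simp only [besselTerm_succ_sub hμ]

theorem hasDerivAt_normBessel {μ : ℝ} (hμ : -(1 / 2) < μ) (x : ℝ) :
    HasDerivAt (normBessel μ) (-(x / (2 * (μ + 1))) * normBessel (μ + 1) x) x := by
  set R := |x| + 1
  have hR : 0 ≤ R := by positivity
  have hx : x ∈ Metric.ball (0 : ℝ) R := by simp [R]
  have hb : ∀ (k : ℕ) (y : ℝ), y ∈ Metric.ball (0 : ℝ) R →
      ‖-(y / (2 * (μ + 1))) * besselTerm (μ + 1) k y‖ ≤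
        R * ((R ^ 2 / 2) ^ k / k.factorial) := by
    intro k y hy
    have hy' : |y| ≤ R := by simpa using (mem_ball_zero_iff.1 hy).le
    have hy2 : y ^ 2 ≤ R ^ 2 := by rw [← sq_abs]; gcongr
    rw [norm_mul]
    refine mul_le_mul ?_ ((abs_besselTerm_le (by linarith) k y).trans (by gcongr))
      (norm_nonneg _) hR
    rw [norm_neg, norm_div, Real.norm_eq_abs, Real.norm_eq_abs,
      abs_of_pos (a := 2 * _) (by linarith)]
    -- The denominator 2(μ+1) exceeds 1 because μ > -1/2.
    exact (div_le_self (abs_nonneg y) (by linarith)).trans hy'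
  have key := hasDerivAt_tsum_of_isPreconnected
    ((Real.summable_pow_div_factorial (R ^ 2 / 2)).mul_left R) Metric.isOpen_ball
    (convex_ball (0 : ℝ) R).isPreconnected
    (fun k y _ => hasDerivAt_besselTerm_succ hμ k y) hb hx
    ((summable_nat_add_iff 1).2 (summable_besselTerm hμ x)) hx
  have h2 : (fun y => ∑' k, besselTerm μ (k + 1) y) = fun y => normBessel μ y - 1 := by
    ext y
    rw [normBessel_eq_tsum, (summable_besselTerm hμ y).tsum_eq_zero_add, besselTerm_zero hμ]
    simp
  rw [h2, tsum_mul_left, ← normBessel_eq_tsum] at key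
  simpa using key.add_const 1

theorem normBessel_neg (μ x : ℝ) : normBessel μ (-x) = normBessel μ x := by
  simp only [normBessel, neg_div, (even_two_mul _).neg_pow]

theorem normBessel_zero {μ : ℝ} (hμ : -(1 / 2) < μ) : normBessel μ 0 = 1 := by
  rw [normBessel_eq_tsum, tsum_eq_single 0 fun k hk => ?_, besselTerm_zero hμ]
  simp [besselTerm, hk]

theorem contDiff_normBessel {μ : ℝ} (hμ : -(1 / 2) < μ) : ContDiff ℝ ∞ (normBessel μ) := by
  refine contDiff_infty.2 fun n => ?_
  induction n generalizing μ with
  | zero =>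
    exact contDiff_zero.2 (continuous_iff_continuousAt.2 fun x =>
      (hasDerivAt_normBessel hμ x).continuousAt)
  | succ n ih =>
    refine contDiff_succ_iff_deriv (n := (n : WithTop ℕ∞)).2
      ⟨fun x => (hasDerivAt_normBessel hμ x).differentiableAt, by simp, ?_⟩
    rw [funext fun x => (hasDerivAt_normBessel hμ x).deriv]
    exact (contDiff_id.div_const _).neg.mul (ih (by linarith))

theorem continuous_normBessel {μ : ℝ} (hμ : -(1 / 2) < μ) : Continuous (normBessel μ) :=
  (contDiff_normBessel hμ).continuous

/-! ### The Dunkl equation: energy estimate, kernel, uniqueness -/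

/-- The energy |w(u)|² + |w(-u)|² decreases on u > 0: the term -ivw is skew and drops out, and the
reflection terms add up to -2(k/u)|w(u) - w(-u)|². -/
theorem norm_sq_add_norm_sq_le_of_dunklOperator_eq {k v : ℝ} (hk : 0 ≤ k) {w : ℝ → ℂ}
    (hw : Differentiable ℝ w) (he : ∀ u, dunklOperator k w u = -Complex.I * v * w u) {u : ℝ}
    (hu : 0 ≤ u) : ‖w u‖ ^ 2 + ‖w (-u)‖ ^ 2 ≤ 2 * ‖w 0‖ ^ 2 := by
  have hd : ∀ u, HasDerivAt (fun u => ‖w u‖ ^ 2 + ‖w (-u)‖ ^ 2)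
      (2 * inner ℝ (w u) (deriv w u) + 2 * inner ℝ (w (-u)) (-deriv w (-u))) u := by
    intro u
    refine (hw u).hasDerivAt.norm_sq.add (HasDerivAt.norm_sq ?_)
    simpa [Function.comp_def] using (hw (-u)).hasDerivAt.scomp u (hasDerivAt_neg u)
  have hanti : AntitoneOn (fun u => ‖w u‖ ^ 2 + ‖w (-u)‖ ^ 2) (Set.Ici 0) := by
    refine antitoneOn_of_deriv_nonpos (convex_Ici 0)
      (fun u _ => (hd u).continuousAt.continuousWithinAt)
      (fun u _ => (hd u).differentiableAt.differentiableWithinAt) fun u hu => ?_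
    rw [interior_Ici, Set.mem_Ioi] at hu
    have e1 := he u
    have e2 := he (-u)
    rw [dunklOperator, if_neg hu.ne'] at e1
    rw [dunklOperator, if_neg (neg_ne_zero.2 hu.ne'), neg_neg] at e2
    have e1' : deriv w u = -Complex.I * v * w u - ((k / u : ℝ) : ℂ) * (w u - w (-u)) := by
      rw [← e1]; push_cast; ring
    have e2' : deriv w (-u) = -Complex.I * v * w (-u) - ((k / u : ℝ) : ℂ) * (w u - w (-u)) := by
      rw [← e2]; push_cast; ring
    have hq : 0 ≤ k / u := by positivity
    rw [(hd u).deriv, e1', e2']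
    generalize k / u = q at hq
    simp only [Complex.inner, Complex.mul_re, Complex.sub_re, Complex.neg_re, Complex.conj_re,
      Complex.conj_im, Complex.mul_im, Complex.sub_im, Complex.neg_im, Complex.I_re, Complex.I_im,
      Complex.ofReal_re, Complex.ofReal_im]
    have h := mul_nonneg hq (add_nonneg (sq_nonneg ((w u).re - (w (-u)).re))
      (sq_nonneg ((w u).im - (w (-u)).im)))
    linarith
  have h := hanti Set.self_mem_Ici hu hu
  simp only [neg_zero] at h
  linarith

theorem norm_sq_le_of_dunklOperator_eq {k v : ℝ} (hk : 0 ≤ k) {w : ℝ → ℂ}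
    (hw : Differentiable ℝ w) (he : ∀ u, dunklOperator k w u = -Complex.I * v * w u) (u : ℝ) :
    ‖w u‖ ^ 2 ≤ 2 * ‖w 0‖ ^ 2 := by
  rcases le_total 0 u with hu | hu
  · have := norm_sq_add_norm_sq_le_of_dunklOperator_eq hk hw he hu
    nlinarith [sq_nonneg ‖w (-u)‖]
  · have := norm_sq_add_norm_sq_le_of_dunklOperator_eq hk hw he (neg_nonneg.2 hu)
    rw [neg_neg] at this
    nlinarith [sq_nonneg ‖w (-u)‖]

theorem oddKernel_zero_left (lam x : ℝ) :
    oddKernel 0 lam x =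
      normBessel lam x - Complex.I * ((x / (2 * (lam + 1)) * normBessel (lam + 1) x : ℝ) : ℂ) := by
  simp [oddKernel]
  ring

theorem hasDerivAt_mul_normBessel {lam : ℝ} (hlam : -(1 / 2) < lam) (x : ℝ) :
    HasDerivAt (fun x => x / (2 * (lam + 1)) * normBessel (lam + 1) x)
      (normBessel lam x - (2 * lam + 1) / (2 * (lam + 1)) * normBessel (lam + 1) x) x := by
  have h1 : 0 < lam + 1 := by linarith
  have h2 : 0 < lam + 2 := by linarith
  refine (((hasDerivAt_id x).div_const (2 * (lam + 1))).mul
    (hasDerivAt_normBessel (μ := lam + 1) (by linarith) x)).congr_deriv ?_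
  rw [normBessel_recurrence hlam x, show lam + 1 + 1 = lam + 2 by ring]
  simp only [id]
  field_simp
  ring

theorem hasDerivAt_oddKernel_zero {lam : ℝ} (hlam : -(1 / 2) < lam) (x : ℝ) :
    HasDerivAt (oddKernel 0 lam)
      (-((x / (2 * (lam + 1)) * normBessel (lam + 1) x : ℝ) : ℂ) - Complex.I *
        ((normBessel lam x - (2 * lam + 1) / (2 * (lam + 1)) * normBessel (lam + 1) x : ℝ) : ℂ))
      x := by
  rw [funext (oddKernel_zero_left lam)]
  refine ((hasDerivAt_normBessel hlam x).ofReal_comp.sub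
    ((hasDerivAt_mul_normBessel hlam x).ofReal_comp.const_mul Complex.I)).congr_deriv ?_
  push_cast
  ring

theorem contDiff_oddKernel_zero {lam : ℝ} (hlam : -(1 / 2) < lam) :
    ContDiff ℝ ∞ (oddKernel 0 lam) := by
  rw [funext (oddKernel_zero_left lam)]
  have h1 := contDiff_normBessel hlam
  have h2 := contDiff_normBessel (μ := lam + 1) (by linarith)
  exact (Complex.ofRealCLM.contDiff.comp h1).sub (contDiff_const.mul
    (Complex.ofRealCLM.contDiff.comp ((contDiff_id.div_const _).mul h2)))

/-- The reflection term sees only the odd part of the kernel, and since 2κ = 2λ+1 it cancels the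
j_{λ+1} term in `hasDerivAt_mul_normBessel`. -/
theorem dunklOperator_oddKernel_zero {lam : ℝ} (hlam : -(1 / 2) < lam) (u v : ℝ) :
    dunklOperator (lam + 1 / 2) (fun u' => oddKernel 0 lam (u' * v)) u =
      -Complex.I * v * oddKernel 0 lam (u * v) := by
  have hd := fun u : ℝ => (hasDerivAt_oddKernel_zero hlam (u * v)).scomp u
    (hasDerivAt_mul_const (x := u) v)
  simp only [Function.comp_def] at hd
  have h1 : (lam : ℂ) + 1 ≠ 0 := by
    have : lam + 1 ≠ 0 := by linarith
    exact_mod_cast this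
  rw [dunklOperator, (hd u).deriv, (hd 0).deriv]
  by_cases hu : u = 0
  · subst hu
    simp only [if_true, zero_mul, oddKernel_zero_left, normBessel_zero hlam,
      normBessel_zero (μ := lam + 1) (by linarith), zero_div, Complex.real_smul]
    push_cast
    field_simp
    ring
  · have hu' : (u : ℂ) ≠ 0 := by exact_mod_cast hu
    simp only [if_neg hu, oddKernel_zero_left, Complex.real_smul, neg_mul u v, normBessel_neg]
    push_cast
    field_simp
    ring_nf
    simp only [Complex.I_sq]
    ring

theorem isDunklKernel_iff {lam : ℝ} (hlam : -(1 / 2) < lam) (E : ℝ → ℝ → ℂ) :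
    IsDunklKernel (lam + 1 / 2) E ↔ E = fun u v => oddKernel 0 lam (u * v) := by
  have hs : ∀ v : ℝ, ContDiff ℝ ∞ fun u => oddKernel 0 lam (u * v) := fun v =>
    (contDiff_oddKernel_zero hlam).comp (contDiff_id.mul contDiff_const)
  have h0 : oddKernel 0 lam 0 = 1 := by simp [oddKernel_zero_left, normBessel_zero hlam]
  constructor
  · intro h
    ext u v
    set F : ℝ → ℂ := fun u => oddKernel 0 lam (u * v)
    have hE : Differentiable ℝ fun u => E u v := (h.smooth v).differentiable (by simp)
    have hF : Differentiable ℝ F := (hs v).differentiable (by simp)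
    have he : ∀ u, dunklOperator (lam + 1 / 2) (fun u => E u v - F u) u =
        -Complex.I * v * (E u v - F u) := by
      intro u
      have e1 := h.eigen u v
      have e2 : dunklOperator (lam + 1 / 2) F u = -Complex.I * v * F u :=
        dunklOperator_oddKernel_zero hlam u v
      rw [mul_sub, ← e1, ← e2]
      simp only [dunklOperator]
      rw [deriv_fun_sub (hE u) (hF u), deriv_fun_sub (hE 0) (hF 0)]
      split_ifs <;> ring
    -- The difference of two kernels solves the same equation and vanishes at 0, so the energy
    -- estimate makes it zero.
    have := norm_sq_le_of_dunklOperator_eq (by linarith) (hE.sub hF) he u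
    have h2 : E 0 v - F 0 = 0 := by simp [F, h0, h.at_zero]
    simp only [Pi.sub_apply, h2, norm_zero] at this
    exact sub_eq_zero.1 (norm_eq_zero.1 (pow_eq_zero_iff two_ne_zero |>.1
      (le_antisymm (by simpa using this) (sq_nonneg _))))
  · rintro rfl
    exact ⟨hs, dunklOperator_oddKernel_zero hlam, fun v => by simp [h0]⟩

/-- The function j_μ is the real part of the Dunkl kernel, whose squared modulus is at most 2 by the
energy estimate; the constant is not sharp. -/
theorem abs_normBessel_le {μ : ℝ} (hμ : -(1 / 2) < μ) (x : ℝ) : |normBessel μ x| ≤ 2 := by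
  have h := norm_sq_le_of_dunklOperator_eq (w := fun u => oddKernel 0 μ (u * 1)) (v := 1)
    (k := μ + 1 / 2) (by linarith)
    (((contDiff_oddKernel_zero hμ).comp (contDiff_id.mul contDiff_const)).differentiable (by simp))
    (fun u => dunklOperator_oddKernel_zero hμ u 1) x
  have h0 : oddKernel 0 μ 0 = 1 := by simp [oddKernel_zero_left, normBessel_zero hμ]
  simp only [mul_one, h0, norm_one] at h
  have h1 : |normBessel μ x| ≤ ‖oddKernel 0 μ x‖ := by
    have h2 := Complex.abs_re_le_norm (oddKernel 0 μ x)
    rwa [show (oddKernel 0 μ x).re = normBessel μ x by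
      simp only [oddKernel_zero_left, Complex.sub_re, Complex.mul_re, Complex.ofReal_re,
        Complex.ofReal_im, Complex.I_re]
      ring] at h2
  nlinarith [abs_nonneg (normBessel μ x)]

/-! ### Schwartz functions and Hadamard division -/

/-- Since all derivatives stay in `A`, decay of the members themselves already bounds every Schwartz
seminorm. -/
theorem mem_schwartzFunctions_of_family {A : Set (ℝ → ℂ)}
    (hd : ∀ g ∈ A, ∃ g' ∈ A, ∀ x, HasDerivAt g (g' x) x)
    (hb : ∀ g ∈ A, ∀ k : ℕ, ∃ C, ∀ x, |x| ^ k * ‖g x‖ ≤ C) : A ⊆ schwartzFunctions := by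
  intro g hg
  have hi : ∀ n, iteratedDeriv n g ∈ A := by
    intro n
    induction n with
    | zero => simpa using hg
    | succ n ih =>
      obtain ⟨g', hg', h⟩ := hd _ ih
      rwa [iteratedDeriv_succ, funext fun x => (h x).deriv]
  refine ⟨⟨g, contDiff_of_differentiable_iteratedDeriv fun n _ x => ?_, fun k n => ?_⟩, rfl⟩
  · obtain ⟨g', hg', h⟩ := hd _ (hi n)
    exact (h x).differentiableAt
  · obtain ⟨C, hC⟩ := hb _ (hi n) k
    exact ⟨C, fun x => by
      simpa [norm_iteratedFDeriv_eq_norm_iteratedDeriv] using hC x⟩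

section SchwartzFunctions

variable {f g : ℝ → ℂ}

theorem contDiff_of_mem_schwartzFunctions (hf : f ∈ schwartzFunctions) : ContDiff ℝ ∞ f := by
  obtain ⟨F, rfl⟩ := hf
  exact F.smooth ⊤

theorem continuous_of_mem_schwartzFunctions (hf : f ∈ schwartzFunctions) : Continuous f :=
  (contDiff_of_mem_schwartzFunctions hf).continuous

theorem hasDerivAt_of_mem_schwartzFunctions (hf : f ∈ schwartzFunctions) (x : ℝ) :
    HasDerivAt f (deriv f x) x :=
  ((contDiff_of_mem_schwartzFunctions hf).differentiable (by simp) x).hasDerivAt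

theorem schwartz_decay (hf : f ∈ schwartzFunctions) (k n : ℕ) :
    ∃ C, ∀ x, |x| ^ k * ‖iteratedDeriv n f x‖ ≤ C := by
  obtain ⟨F, rfl⟩ := hf
  exact ⟨_, fun x => F.le_seminorm' ℝ k n x⟩

theorem schwartz_add (hf : f ∈ schwartzFunctions) (hg : g ∈ schwartzFunctions) :
    (fun x => f x + g x) ∈ schwartzFunctions := by
  obtain ⟨F, rfl⟩ := hf
  obtain ⟨G, rfl⟩ := hg
  exact ⟨F + G, rfl⟩

theorem schwartz_const_mul (hf : f ∈ schwartzFunctions) (c : ℂ) :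
    (fun x => c * f x) ∈ schwartzFunctions := by
  obtain ⟨F, rfl⟩ := hf
  exact ⟨c • F, rfl⟩

theorem schwartz_comp_neg (hf : f ∈ schwartzFunctions) :
    (fun x => f (-x)) ∈ schwartzFunctions := by
  obtain ⟨F, rfl⟩ := hf
  exact ⟨SchwartzMap.compCLMOfContinuousLinearEquiv ℝ (ContinuousLinearEquiv.neg ℝ) F, rfl⟩

theorem schwartz_comp_sub (hf : f ∈ schwartzFunctions) (a : ℝ) :
    (fun x => f (x - a)) ∈ schwartzFunctions := by
  obtain ⟨F, rfl⟩ := hf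
  exact ⟨SchwartzMap.compSubConstCLM ℝ a F, funext fun x => by simp⟩

theorem schwartz_deriv (hf : f ∈ schwartzFunctions) : deriv f ∈ schwartzFunctions := by
  obtain ⟨F, rfl⟩ := hf
  exact ⟨SchwartzMap.derivCLM ℝ ℂ F, funext fun x => by simp⟩

theorem schwartz_id_mul (hf : f ∈ schwartzFunctions) :
    (fun x : ℝ => (x : ℂ) * f x) ∈ schwartzFunctions := by
  obtain ⟨F, rfl⟩ := hf
  refine ⟨SchwartzMap.smulLeftCLM ℂ (fun x : ℝ => x) F, funext fun x => ?_⟩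
  exact (SchwartzMap.smulLeftCLM_apply_apply (by fun_prop) F x).trans (by simp)

theorem schwartz_pow_mul (hf : f ∈ schwartzFunctions) (n : ℕ) :
    (fun x : ℝ => (x : ℂ) ^ n * f x) ∈ schwartzFunctions := by
  induction n with
  | zero => simpa using hf
  | succ n ih => simpa only [pow_succ', mul_assoc] using schwartz_id_mul ih

/-- Hadamard's lemma for Schwartz functions. -/
theorem exists_schwartz_eq_id_mul (hf : f ∈ schwartzFunctions) (h0 : f 0 = 0) :
    ∃ g ∈ schwartzFunctions, ∀ x : ℝ, f x = x * g x := by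
  set D : ℕ → ℝ → ℂ := fun n => iteratedDeriv n f
  have hfs := contDiff_of_mem_schwartzFunctions hf
  have hDd : ∀ n x, HasDerivAt (D n) (D (n + 1) x) x := fun n x => by
    have := (hfs.differentiable_iteratedDeriv n (by exact_mod_cast ENat.natCast_lt_top n) x).hasDerivAt
    rwa [← iteratedDeriv_succ] at this
  have hDc : ∀ n, Continuous (D n) := fun n =>
    continuous_iff_continuousAt.2 fun x => (hDd n x).continuousAt
  have hDb : ∀ n, ∃ C, ∀ x, ‖D n x‖ ≤ C := fun n => by simpa using schwartz_decay hf 0 n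
  -- `G 0` is the quotient f(x)/x, and `G n` is its n-th derivative, obtained under the integral
  -- sign.
  set G : ℕ → ℝ → ℂ := fun n x => ∫ t in (0 : ℝ)..1, (t : ℂ) ^ n * D (n + 1) (t * x)
  have hc : ∀ m n x, Continuous fun t : ℝ => (t : ℂ) ^ m * D n (t * x) := fun m n x =>
    (Complex.continuous_ofReal.pow m).mul ((hDc n).comp (continuous_id.mul continuous_const))
  have hunit : ∀ t ∈ Set.uIoc (0 : ℝ) 1, |t| ≤ 1 := fun t ht => by
    rw [Set.uIoc_of_le zero_le_one] at ht
    rw [abs_of_pos ht.1]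
    exact ht.2
  have hbd : ∀ m n C x, (∀ y, ‖D n y‖ ≤ C) → ∀ t ∈ Set.uIoc (0 : ℝ) 1,
      ‖(t : ℂ) ^ m * D n (t * x)‖ ≤ C := by
    intro m n C x hC t ht
    rw [norm_mul, norm_pow, Complex.norm_real]
    exact (mul_le_of_le_one_left (norm_nonneg _) (pow_le_one₀ (norm_nonneg _) (hunit t ht))).trans
      (hC _)
  have hGd : ∀ n x, HasDerivAt (G n) (G (n + 1) x) x := by
    intro n x
    obtain ⟨C, hC⟩ := hDb (n + 2)
    refine (intervalIntegral.hasDerivAt_integral_of_dominated_loc_of_deriv_le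
      (F' := fun x t => (t : ℂ) ^ (n + 1) * D (n + 2) (t * x)) (bound := fun _ => C)
      (Filter.univ_mem) (.of_forall fun y => (hc _ _ y).aestronglyMeasurable)
      ((hc _ _ x).intervalIntegrable _ _) (hc _ _ x).aestronglyMeasurable
      (.of_forall fun t ht y _ => hbd _ _ C y hC t ht) intervalIntegrable_const
      (.of_forall fun t _ y _ => ?_)).2
    have h1 := (hDd (n + 1) (t * y)).scomp y (hasDerivAt_const_mul (x := y) t)
    simp only [Function.comp_def] at h1
    refine (h1.const_mul ((t : ℂ) ^ n)).congr_deriv ?_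
    rw [Complex.real_smul]
    ring
  -- Integrate d/dt (t^(n+1) f^(n+1)(tx)) over [0, 1]. The identity trades a factor x on `G (n + 1)`
  -- for terms already known to decay.
  have hrec : ∀ n (x : ℝ), D (n + 1) x = (n + 1) * G n x + x * G (n + 1) x := by
    intro n x
    have hd : ∀ t ∈ Set.uIcc (0 : ℝ) 1,
        HasDerivAt (fun t : ℝ => (t : ℂ) ^ (n + 1) * D (n + 1) (t * x))
        ((n + 1) * ((t : ℂ) ^ n * D (n + 1) (t * x)) +
          x * ((t : ℂ) ^ (n + 1) * D (n + 2) (t * x))) t := by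
      intro t _
      have h1 := (hDd (n + 1) (t * x)).scomp t (hasDerivAt_mul_const (x := t) x)
      simp only [Function.comp_def] at h1
      have h2 := ((hasDerivAt_id (t : ℝ)).ofReal_comp.pow (n + 1)).mul h1
      refine h2.congr_deriv ?_
      simp only [id, Complex.real_smul]
      push_cast
      simp
      ring
    have hi1 := (hc n (n + 1) x).intervalIntegrable (μ := volume) 0 1
    have hi2 := (hc (n + 1) (n + 2) x).intervalIntegrable (μ := volume) 0 1
    have := intervalIntegral.integral_eq_sub_of_hasDerivAt hd
      ((hi1.const_mul _).add (hi2.const_mul _))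
    rw [intervalIntegral.integral_add (hi1.const_mul _) (hi2.const_mul _),
      intervalIntegral.integral_const_mul, intervalIntegral.integral_const_mul] at this
    simpa using this.symm
  have hbase : ∀ x : ℝ, f x = x * G 0 x := by
    intro x
    have hd : ∀ t ∈ Set.uIcc (0 : ℝ) 1, HasDerivAt (fun t : ℝ => D 0 (t * x))
        (x * ((t : ℂ) ^ 0 * D 1 (t * x))) t := by
      intro t _
      have h1 := (hDd 0 (t * x)).scomp t (hasDerivAt_mul_const (x := t) x)
      simp only [Function.comp_def] at h1
      refine h1.congr_deriv ?_
      rw [Complex.real_smul, pow_zero, one_mul]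
    have hi := (hc 0 1 x).intervalIntegrable (μ := volume) 0 1
    have := intervalIntegral.integral_eq_sub_of_hasDerivAt hd (hi.const_mul _)
    rw [intervalIntegral.integral_const_mul] at this
    simpa [D, G, h0] using this.symm
  have hGb : ∀ n k : ℕ, ∃ C, ∀ x, |x| ^ k * ‖G n x‖ ≤ C := by
    intro n
    induction n with
    | zero =>
      intro k
      rcases k with - | k
      · obtain ⟨C, hC⟩ := hDb 1
        refine ⟨C, fun x => ?_⟩
        simpa [G] using intervalIntegral.norm_integral_le_of_norm_le_const (hbd 0 1 C x hC)
      · obtain ⟨C, hC⟩ := schwartz_decay hf k 0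
        refine ⟨C, fun x => (le_of_eq ?_).trans (hC x)⟩
        rw [iteratedDeriv_zero, hbase x, norm_mul, Complex.norm_real, Real.norm_eq_abs]
        ring
    | succ n ih =>
      intro k
      rcases k with - | k
      · obtain ⟨C, hC⟩ := hDb (n + 2)
        refine ⟨C, fun x => ?_⟩
        simpa [G] using intervalIntegral.norm_integral_le_of_norm_le_const (hbd (n + 1) (n + 2) C x hC)
      · obtain ⟨C, hC⟩ := schwartz_decay hf k (n + 1)
        obtain ⟨C', hC'⟩ := ih k
        refine ⟨C + (n + 1) * C', fun x => ?_⟩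
        have h1 : (x : ℂ) * G (n + 1) x = D (n + 1) x - (n + 1) * G n x := by
          rw [hrec n x]; ring
        have h2 : |x| * ‖G (n + 1) x‖ ≤ ‖D (n + 1) x‖ + (n + 1) * ‖G n x‖ := by
          rw [← Real.norm_eq_abs, ← Complex.norm_real, ← norm_mul, h1]
          refine (norm_sub_le _ _).trans (le_of_eq ?_)
          rw [norm_mul]
          congr 2
          exact_mod_cast Complex.norm_natCast (n + 1)
        calc |x| ^ (k + 1) * ‖G (n + 1) x‖ = |x| ^ k * (|x| * ‖G (n + 1) x‖) := by ring
          _ ≤ |x| ^ k * (‖D (n + 1) x‖ + (n + 1) * ‖G n x‖) := by gcongr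
          _ = |x| ^ k * ‖D (n + 1) x‖ + (n + 1) * (|x| ^ k * ‖G n x‖) := by ring
          _ ≤ _ := add_le_add (hC x) (by gcongr; exact hC' x)
  refine ⟨G 0, mem_schwartzFunctions_of_family (A := Set.range G) ?_ ?_ ⟨0, rfl⟩, hbase⟩
  · rintro _ ⟨n, rfl⟩
    exact ⟨G (n + 1), ⟨n + 1, rfl⟩, hGd n⟩
  · rintro _ ⟨n, rfl⟩ k
    exact hGb n k

end SchwartzFunctions

/-! ### Parity and the structure of S_r -/

/-- The even Schwartz functions on the real line. -/
def evenSchwartz : Set (ℝ → ℂ) := {f | f ∈ schwartzFunctions ∧ ∀ x, f (-x) = f x}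

theorem eq_of_forall_ne {p q : ℝ → ℂ} (hp : Continuous p) (hq : Continuous q) {s : Set ℝ}
    (hs : s.Finite) (h : ∀ x ∉ s, p x = q x) : p = q :=
  hp.ext_on (hs.countable.dense_compl ℝ) hq fun x hx => h x hx

theorem even_of_odd_eq_id_mul {f g : ℝ → ℂ} (hg : Continuous g)
    (hf : ∀ x, f (-x) = -f x) (h : ∀ x : ℝ, f x = x * g x) (x : ℝ) : g (-x) = g x := by
  refine congrFun (eq_of_forall_ne (p := fun x => g (-x)) (hg.comp continuous_neg) hg
    (Set.finite_singleton 0) fun x hx => ?_) x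
  have hx' : (x : ℂ) ≠ 0 := by simpa using hx
  have h1 := hf x
  rw [h x, h (-x)] at h1
  push_cast at h1
  exact mul_left_cancel₀ hx' (by linear_combination -h1)

theorem odd_of_even_eq_id_mul {f g : ℝ → ℂ} (hg : Continuous g)
    (hf : ∀ x, f (-x) = f x) (h : ∀ x : ℝ, f x = x * g x) (x : ℝ) : g (-x) = -g x := by
  refine congrFun (eq_of_forall_ne (p := fun x => g (-x)) (hg.comp continuous_neg) hg.neg
    (Set.finite_singleton 0) fun x hx => ?_) x
  have hx' : (x : ℂ) ≠ 0 := by simpa using hx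
  have h1 := hf x
  rw [h x, h (-x)] at h1
  push_cast at h1
  exact mul_left_cancel₀ hx' (by rw [Pi.neg_apply]; linear_combination -h1)

theorem zero_of_odd {f : ℝ → ℂ} (hf : ∀ x, f (-x) = -f x) : f 0 = 0 := by
  simpa [eq_neg_iff_add_eq_zero] using hf 0

theorem exists_evenSchwartz_of_odd {f : ℝ → ℂ} (hf : f ∈ schwartzFunctions)
    (hodd : ∀ x, f (-x) = -f x) : ∃ g ∈ evenSchwartz, ∀ x : ℝ, f x = x * g x := by
  obtain ⟨g, hg, h⟩ := exists_schwartz_eq_id_mul hf (zero_of_odd hodd)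
  exact ⟨g, ⟨hg, even_of_odd_eq_id_mul (continuous_of_mem_schwartzFunctions hg) hodd h⟩, h⟩

theorem exists_odd_schwartz_of_even {f : ℝ → ℂ} (hf : f ∈ evenSchwartz) (h0 : f 0 = 0) :
    ∃ g ∈ schwartzFunctions, (∀ x, g (-x) = -g x) ∧ ∀ x : ℝ, f x = x * g x := by
  obtain ⟨g, hg, h⟩ := exists_schwartz_eq_id_mul hf.1 h0
  exact ⟨g, hg, odd_of_even_eq_id_mul (continuous_of_mem_schwartzFunctions hg) hf.2 h, h⟩

theorem exists_evenSchwartz_of_even {f : ℝ → ℂ} (hf : f ∈ evenSchwartz) (h0 : f 0 = 0) :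
    ∃ g ∈ evenSchwartz, ∀ x : ℝ, f x = x ^ 2 * g x := by
  obtain ⟨k, hk, hodd, h⟩ := exists_odd_schwartz_of_even hf h0
  obtain ⟨g, hg, h'⟩ := exists_evenSchwartz_of_odd hk hodd
  exact ⟨g, hg, fun x => by rw [h, h']; ring⟩

/-- The derivative is odd, hence divisible by x. The quotient f'/x is what the index shifts of the
Hankel transform act on. -/
theorem exists_evenSchwartz_deriv {f : ℝ → ℂ} (hf : f ∈ evenSchwartz) :
    ∃ g ∈ evenSchwartz, ∀ x : ℝ, HasDerivAt f (x * g x) x := by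
  have hodd : ∀ x, deriv f (-x) = -deriv f x := fun x => by
    have := deriv_comp_neg f x
    rw [funext hf.2] at this
    rw [this, neg_neg]
  obtain ⟨g, hg, h⟩ := exists_evenSchwartz_of_odd (schwartz_deriv hf.1) hodd
  exact ⟨g, hg, fun x => h x ▸ hasDerivAt_of_mem_schwartzFunctions hf.1 x⟩

theorem exists_schwartz_eq_sub_mul {f : ℝ → ℂ} (hf : f ∈ schwartzFunctions) {a : ℝ}
    (ha : f a = 0) : ∃ g ∈ schwartzFunctions, ∀ x : ℝ, f x = (x - a) * g x := by
  obtain ⟨g, hg, h⟩ := exists_schwartz_eq_id_mul (schwartz_comp_sub hf (-a)) (by simpa using ha)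
  exact ⟨_, schwartz_comp_sub hg a, fun x => by simpa using h (x - a)⟩

theorem exists_evenSchwartz_eq_sq_sub_mul {f : ℝ → ℂ} (hf : f ∈ evenSchwartz) {a : ℝ}
    (ha : f a = 0) : ∃ g ∈ evenSchwartz, ∀ x : ℝ, f x = (x ^ 2 - a ^ 2) * g x := by
  -- For a = 0 evenness makes the zero double; for a ≠ 0 it supplies the second root -a.
  rcases eq_or_ne a 0 with rfl | ha0
  · simpa using exists_evenSchwartz_of_even hf ha
  have ha0' : (a : ℂ) ≠ 0 := by exact_mod_cast ha0
  obtain ⟨k, hk, h⟩ := exists_schwartz_eq_sub_mul hf.1 ha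
  have hka : k (-a) = 0 := by
    have h1 := h (-a)
    rw [hf.2, ha] at h1
    push_cast at h1
    have h2 : (-(a : ℂ) - a) ≠ 0 := by
      rw [show -(a : ℂ) - a = -(2 * a) by ring]
      exact neg_ne_zero.2 (mul_ne_zero two_ne_zero ha0')
    exact (mul_eq_zero.1 h1.symm).resolve_left h2
  obtain ⟨g, hg, h'⟩ := exists_schwartz_eq_sub_mul hk hka
  have h2 : ∀ x : ℝ, f x = (x ^ 2 - a ^ 2) * g x := fun x => by
    rw [h, h']; push_cast; ring
  have hgc := continuous_of_mem_schwartzFunctions hg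
  refine ⟨g, ⟨hg, fun x => congrFun (eq_of_forall_ne (p := fun x => g (-x))
    (hgc.comp continuous_neg) hgc (Set.toFinite {a, -a}) fun x hx => ?_) x⟩, h2⟩
  have hx' : (x : ℂ) ^ 2 - a ^ 2 ≠ 0 := by
    simp only [Set.mem_insert_iff, Set.mem_singleton_iff, not_or] at hx
    rw [sub_ne_zero]
    intro h
    rcases sq_eq_sq_iff_eq_or_eq_neg.1 (show x ^ 2 = a ^ 2 by exact_mod_cast h) with h | h
    exacts [hx.1 h, hx.2 h]
  have h3 := hf.2 x
  rw [h2, h2] at h3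
  push_cast at h3
  rw [neg_sq] at h3
  exact mul_left_cancel₀ hx' h3

theorem iteratedDeriv_id_mul {f : ℝ → ℂ} (hf : ContDiff ℝ ∞ f) (n : ℕ) :
    iteratedDeriv (n + 1) (fun x : ℝ => (x : ℂ) * f x) 0 = (n + 1) * iteratedDeriv n f 0 := by
  -- The induction differentiates, so it needs the Leibniz formula at every x.
  suffices h : ∀ (n : ℕ) (x : ℝ), iteratedDeriv (n + 1) (fun x : ℝ => (x : ℂ) * f x) x =
      (n + 1) * iteratedDeriv n f x + x * iteratedDeriv (n + 1) f x by simpa using h n 0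
  have hd : ∀ n x, HasDerivAt (iteratedDeriv n f) (iteratedDeriv (n + 1) f x) x := fun n x => by
    have := (hf.differentiable_iteratedDeriv n (by exact_mod_cast ENat.natCast_lt_top n) x).hasDerivAt
    rwa [← iteratedDeriv_succ] at this
  have hid : ∀ x : ℝ, HasDerivAt (fun x : ℝ => (x : ℂ)) 1 x := fun x =>
    (hasDerivAt_id x).ofReal_comp
  intro n
  induction n with
  | zero =>
    intro x
    have h := (hid x).mul (hd 0 x)
    simp only [iteratedDeriv_zero] at h
    rw [zero_add, iteratedDeriv_one]
    refine h.deriv.trans ?_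
    simp
  | succ n ih =>
    intro x
    rw [iteratedDeriv_succ, funext ih]
    refine (((hd n x).const_mul _).add ((hid x).mul (hd (n + 1) x))).deriv.trans ?_
    push_cast
    ring

theorem iteratedDeriv_pow_mul_of_lt {f : ℝ → ℂ} (hf : f ∈ schwartzFunctions) {m n : ℕ}
    (h : m < n) : iteratedDeriv m (fun x : ℝ => (x : ℂ) ^ n * f x) 0 = 0 := by
  induction n generalizing m with
  | zero => omega
  | succ n ih =>
    simp only [pow_succ', mul_assoc]
    rcases m with - | m
    · simp
    · rw [iteratedDeriv_id_mul (contDiff_of_mem_schwartzFunctions (schwartz_pow_mul hf n)),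
        ih (by omega), mul_zero]

theorem iteratedDeriv_pow_mul_self {f : ℝ → ℂ} (hf : f ∈ schwartzFunctions) (n : ℕ) :
    iteratedDeriv n (fun x : ℝ => (x : ℂ) ^ n * f x) 0 = n.factorial * f 0 := by
  induction n with
  | zero => simp
  | succ n ih =>
    simp only [pow_succ', mul_assoc]
    rw [iteratedDeriv_id_mul (contDiff_of_mem_schwartzFunctions (schwartz_pow_mul hf n)), ih,
      Nat.factorial_succ]
    push_cast
    ring

theorem iteratedDeriv_even_zero {f : ℝ → ℂ} (hf : ∀ x, f (-x) = f x) (s : ℕ) :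
    iteratedDeriv (2 * s + 1) f 0 = 0 := by
  have h := iteratedDeriv_comp_neg (2 * s + 1) f 0
  rw [funext hf, neg_zero, (odd_two_mul_add_one s).neg_one_pow, neg_one_smul] at h
  simpa [eq_neg_iff_add_eq_zero] using h

/-- If f = x^(2r+1) k, the derivative of order 2r+1 at 0 is (2r+1)! k(0); its vanishing lets the
even function k give up another x². -/
theorem exists_evenSchwartz_of_odd_of_iteratedDeriv {f : ℝ → ℂ} (hf : f ∈ schwartzFunctions)
    (hodd : ∀ x, f (-x) = -f x) (r : ℕ) (hr : ∀ s < r, iteratedDeriv (2 * s + 1) f 0 = 0) :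
    ∃ h ∈ evenSchwartz, ∀ x : ℝ, f x = x ^ (2 * r + 1) * h x := by
  induction r with
  | zero => simpa using exists_evenSchwartz_of_odd hf hodd
  | succ r ih =>
    obtain ⟨k, hk, h⟩ := ih fun s hs => hr s (by omega)
    have h0 := hr r (by omega)
    rw [funext h, iteratedDeriv_pow_mul_self hk.1] at h0
    have hk0 : k 0 = 0 := (mul_eq_zero.1 h0).resolve_left (by exact_mod_cast Nat.factorial_ne_zero _)
    obtain ⟨g, hg, h'⟩ := exists_evenSchwartz_of_even hk hk0
    exact ⟨g, hg, fun x => by rw [h, h']; ring⟩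

theorem mem_schwartzOddVanishing_iff (r : ℕ) (g : ℝ → ℂ) :
    g ∈ schwartzOddVanishing r ↔ ∃ f ∈ evenSchwartz, ∃ h ∈ evenSchwartz,
      g = fun x : ℝ => f x + (x : ℂ) ^ (2 * r + 1) * h x := by
  constructor
  · rintro ⟨hg, hr⟩
    have hn := schwartz_comp_neg hg
    have hf : (fun x => 1 / 2 * (g x + g (-x))) ∈ evenSchwartz :=
      ⟨schwartz_const_mul (schwartz_add hg hn) _, fun x => by simp only [neg_neg]; ring⟩
    have ho : (fun x => 1 / 2 * (g x + -1 * g (-x))) ∈ schwartzFunctions :=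
      schwartz_const_mul (schwartz_add hg (schwartz_const_mul hn _)) _
    obtain ⟨h, hh, he⟩ := exists_evenSchwartz_of_odd_of_iteratedDeriv ho
      (fun x => by simp only [neg_neg]; ring) r fun s hs => by
        have hsm : ∀ p ∈ schwartzFunctions, ContDiffAt ℝ (2 * s + 1 : ℕ) p 0 := fun p hp =>
          (contDiff_infty.1 (contDiff_of_mem_schwartzFunctions hp) _).contDiffAt
        rw [iteratedDeriv_const_mul_field, iteratedDeriv_fun_add (hsm _ hg)
          (hsm _ (schwartz_const_mul hn _)), iteratedDeriv_const_mul_field, hr s hs,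
          iteratedDeriv_comp_neg, neg_zero, hr s hs]
        simp
    refine ⟨_, hf, h, hh, funext fun x => ?_⟩
    rw [← he x]
    ring
  · rintro ⟨f, hf, h, hh, rfl⟩
    have hp := schwartz_pow_mul hh.1 (2 * r + 1)
    refine ⟨schwartz_add hf.1 hp, fun s hs => ?_⟩
    have hsm : ∀ p ∈ schwartzFunctions, ContDiffAt ℝ (2 * s + 1 : ℕ) p 0 := fun p hp =>
      (contDiff_infty.1 (contDiff_of_mem_schwartzFunctions hp) _).contDiffAt
    rw [iteratedDeriv_fun_add (hsm _ hf.1) (hsm _ hp), iteratedDeriv_even_zero hf.2,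
      iteratedDeriv_pow_mul_of_lt hh.1 (by omega), add_zero]

theorem schwartzOddVanishing_zero : schwartzOddVanishing 0 = schwartzFunctions := by
  simp [schwartzOddVanishing]

/-! ### Polynomial growth and the weight -/

/-- Continuity together with polynomial growth at infinity. -/
structure PolyGrowth (w : ℝ → ℂ) : Prop where
  continuous : Continuous w
  growth : ∃ (C : ℝ) (N : ℕ), ∀ u, ‖w u‖ ≤ C * (1 + |u|) ^ N

theorem PolyGrowth.mul {w z : ℝ → ℂ} (hw : PolyGrowth w) (hz : PolyGrowth z) :
    PolyGrowth fun u => w u * z u := by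
  obtain ⟨hwc, C, N, hC⟩ := hw
  obtain ⟨hzc, D, M, hD⟩ := hz
  refine ⟨hwc.mul hzc, C * D, N + M, fun u => ?_⟩
  rw [norm_mul]
  refine (mul_le_mul (hC u) (hD u) (norm_nonneg _) ((norm_nonneg _).trans (hC u))).trans
    (le_of_eq ?_)
  ring

theorem PolyGrowth.of_bounded {w : ℝ → ℂ} (hw : Continuous w) {C : ℝ} (hC : ∀ u, ‖w u‖ ≤ C) :
    PolyGrowth w :=
  ⟨hw, C, 0, by simpa using hC⟩

theorem polyGrowth_const (c : ℂ) : PolyGrowth fun _ => c :=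
  .of_bounded continuous_const fun _ => le_rfl

theorem polyGrowth_ofReal : PolyGrowth fun u => (u : ℂ) :=
  ⟨Complex.continuous_ofReal, 1, 1, fun u => by simp⟩

theorem polyGrowth_ofReal_pow (n : ℕ) : PolyGrowth fun u => (u : ℂ) ^ n := by
  induction n with
  | zero => simpa using polyGrowth_const 1
  | succ n ih => simpa only [pow_succ] using ih.mul polyGrowth_ofReal

theorem PolyGrowth.integrable_mul {w f : ℝ → ℂ} (hw : PolyGrowth w)
    (hf : f ∈ schwartzFunctions) : Integrable fun u => w u * f u := by
  obtain ⟨hwc, C, N, hC⟩ := hw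
  have hfc := continuous_of_mem_schwartzFunctions hf
  obtain ⟨F, rfl⟩ := hf
  have h0 := F.integrable_pow_mul volume 0
  have hN := F.integrable_pow_mul volume N
  refine (((h0.add hN).const_mul (2 ^ (N - 1))).const_mul |C|).mono'
    (hwc.mul hfc).aestronglyMeasurable (.of_forall fun u => ?_)
  rw [norm_mul]
  calc ‖w u‖ * ‖F u‖ ≤ (|C| * (1 + |u|) ^ N) * ‖F u‖ := by
        gcongr
        exact (hC u).trans (by gcongr; exact le_abs_self C)
    _ ≤ (|C| * (2 ^ (N - 1) * (1 ^ N + |u| ^ N))) * ‖F u‖ := by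
        gcongr
        exact add_pow_le zero_le_one (abs_nonneg u) N
    _ = _ := by
        simp only [Pi.add_apply, one_pow, pow_zero, Real.norm_eq_abs]
        ring

theorem nuDensity_add_one {μ : ℝ} (hμ : -(1 / 2) < μ) (u : ℝ) :
    nuDensity (μ + 1) u = u ^ 2 / (2 * (μ + 1)) * nuDensity μ u := by
  have h1 : 0 < μ + 1 := by linarith
  have h2 : |u| ^ (2 * (μ + 1) + 1) = u ^ 2 * |u| ^ (2 * μ + 1) := by
    rw [show 2 * (μ + 1) + 1 = (2 * μ + 1) + (2 : ℕ) by push_cast; ring,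
      Real.rpow_add_natCast' (abs_nonneg u) (by push_cast; linarith), sq_abs]
    ring
  have h3 : 0 < Real.Gamma (μ + 1) := Real.Gamma_pos_of_pos h1
  rw [nuDensity, nuDensity, h2, Real.Gamma_add_one h1.ne', Real.rpow_add_one two_ne_zero]
  have h4 : (0 : ℝ) < 2 ^ (μ + 1) := by positivity
  field_simp

theorem nuDensity_neg (μ u : ℝ) : nuDensity μ (-u) = nuDensity μ u := by
  simp [nuDensity]

theorem continuous_nuDensity {μ : ℝ} (hμ : -(1 / 2) < μ) : Continuous (nuDensity μ) :=
  (continuous_abs.rpow_const fun _ => Or.inr (by linarith)).div_const _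

theorem polyGrowth_nuDensity {μ : ℝ} (hμ : -(1 / 2) < μ) :
    PolyGrowth fun u => (nuDensity μ u : ℂ) := by
  have h3 : 0 < Real.Gamma (μ + 1) := Real.Gamma_pos_of_pos (by linarith)
  refine ⟨Complex.continuous_ofReal.comp (continuous_nuDensity hμ),
    1 / (2 ^ (μ + 1) * Real.Gamma (μ + 1)), ⌈2 * μ + 1⌉₊, fun u => ?_⟩
  have h4 : |u| ^ (2 * μ + 1) ≤ (1 + |u|) ^ ⌈2 * μ + 1⌉₊ :=
    calc |u| ^ (2 * μ + 1) ≤ (1 + |u|) ^ (2 * μ + 1) :=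
          Real.rpow_le_rpow (abs_nonneg u) (by linarith) (by linarith)
      _ ≤ (1 + |u|) ^ ((⌈2 * μ + 1⌉₊ : ℕ) : ℝ) :=
          Real.rpow_le_rpow_of_exponent_le (by linarith [abs_nonneg u]) (Nat.le_ceil _)
      _ = _ := Real.rpow_natCast _ _
  rw [Complex.norm_real, nuDensity, Real.norm_eq_abs, abs_of_nonneg (by positivity),
    one_div_mul_eq_div]
  gcongr

theorem polyGrowth_normBessel {μ : ℝ} (hμ : -(1 / 2) < μ) (v : ℝ) :
    PolyGrowth fun u => (normBessel μ (u * v) : ℂ) :=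
  .of_bounded (Complex.continuous_ofReal.comp ((continuous_normBessel hμ).comp
    (continuous_id.mul continuous_const))) (C := 2) fun u => by
      simpa using abs_normBessel_le hμ (u * v)

theorem hasDerivAt_mul_nuDensity {μ : ℝ} (hμ : -(1 / 2) < μ) (u : ℝ) :
    HasDerivAt (fun u => u * nuDensity μ u) ((2 * μ + 2) * nuDensity μ u) u := by
  suffices h : HasDerivAt (fun u => u * |u| ^ (2 * μ + 1)) ((2 * μ + 2) * |u| ^ (2 * μ + 1)) u by
    simpa only [nuDensity, mul_div_assoc] using
      h.div_const (2 ^ (μ + 1) * Real.Gamma (μ + 1))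
  -- At 0 the difference quotient is the power |u|^(2μ+1) itself, which tends to 0 because 2μ+1 > 0.
  rcases eq_or_ne u 0 with rfl | hu
  · have hs : 2 * μ + 1 ≠ 0 := by linarith
    have hc : Continuous fun u : ℝ => |u| ^ (2 * μ + 1) :=
      continuous_abs.rpow_const fun _ => Or.inr (by linarith)
    rw [hasDerivAt_iff_tendsto_slope]
    have h1 : Filter.Tendsto (fun u : ℝ => |u| ^ (2 * μ + 1)) (nhdsWithin 0 {0}ᶜ)
        (nhds ((2 * μ + 2) * |0| ^ (2 * μ + 1))) := by
      have := (hc.tendsto 0).mono_left (nhdsWithin_le_nhds (s := {(0 : ℝ)}ᶜ))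
      simpa [Real.zero_rpow hs] using this
    refine h1.congr' ?_
    filter_upwards [self_mem_nhdsWithin] with x hx
    have hx' : x ≠ 0 := hx
    simp [slope_def_field, hx']
  · have h1 := (hasDerivAt_id u).mul ((hasDerivAt_abs hu).rpow_const (p := 2 * μ + 1)
      (Or.inl (abs_ne_zero.2 hu)))
    refine h1.congr_deriv ?_
    have h2 : |u| ^ (2 * μ + 1) = |u| ^ (2 * μ + 1 - 1) * |u| := by
      rw [← Real.rpow_add_one (abs_ne_zero.2 hu)]; ring_nf
    have h3 : u * (SignType.sign u : ℝ) = |u| := self_mul_sign u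
    simp only [id]
    rw [h2]
    linear_combination (2 * μ + 1) * |u| ^ (2 * μ + 1 - 1) * h3

/-! ### Hankel transform: index shifts and the Schwartz class -/

/-- The Hankel transform of index `μ`, with the normalized Bessel function as kernel. -/
noncomputable def hankel (μ : ℝ) (f : ℝ → ℂ) (v : ℝ) : ℂ :=
  ∫ u : ℝ, (normBessel μ (u * v) : ℂ) * (nuDensity μ u : ℂ) * f u

section Hankel

variable {μ : ℝ} {f g h k : ℝ → ℂ}

theorem polyGrowth_hankelKernel (hμ : -(1 / 2) < μ) (v : ℝ) :
    PolyGrowth fun u => (normBessel μ (u * v) : ℂ) * (nuDensity μ u : ℂ) :=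
  (polyGrowth_normBessel hμ v).mul (polyGrowth_nuDensity hμ)

theorem integrable_hankel (hμ : -(1 / 2) < μ) (hf : f ∈ schwartzFunctions) (v : ℝ) :
    Integrable fun u => (normBessel μ (u * v) : ℂ) * (nuDensity μ u : ℂ) * f u :=
  (polyGrowth_hankelKernel hμ v).integrable_mul hf

theorem hankel_add (hμ : -(1 / 2) < μ) (hf : f ∈ schwartzFunctions)
    (hg : g ∈ schwartzFunctions) (v : ℝ) :
    hankel μ (fun u => f u + g u) v = hankel μ f v + hankel μ g v := by
  simp only [hankel, mul_add]
  exact integral_add (integrable_hankel hμ hf v) (integrable_hankel hμ hg v)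

theorem hankel_const_mul (c : ℂ) (v : ℝ) :
    hankel μ (fun u => c * f u) v = c * hankel μ f v := by
  simp only [hankel, ← integral_const_mul]
  congr 1 with u
  ring

theorem hankel_neg_apply (v : ℝ) : hankel μ f (-v) = hankel μ f v := by
  simp only [hankel, mul_neg, normBessel_neg]

theorem norm_hankel_le (hμ : -(1 / 2) < μ) (hf : f ∈ schwartzFunctions) :
    ∃ C, ∀ v, ‖hankel μ f v‖ ≤ C := by
  refine ⟨∫ u, 2 * ‖(nuDensity μ u : ℂ) * f u‖, fun v => norm_integral_le_of_norm_le
    (((polyGrowth_nuDensity hμ).integrable_mul hf).norm.const_mul 2) (.of_forall fun u => ?_)⟩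
  rw [mul_assoc, norm_mul, Complex.norm_real]
  gcongr
  exact abs_normBessel_le hμ _

theorem hasDerivAt_normBessel_comp_mul (hμ : -(1 / 2) < μ) (u v : ℝ) :
    HasDerivAt (fun u => (normBessel μ (u * v) : ℂ))
      (-((u * v ^ 2 / (2 * (μ + 1)) * normBessel (μ + 1) (u * v) : ℝ) : ℂ)) u := by
  have h := ((hasDerivAt_normBessel hμ (u * v)).comp u (hasDerivAt_mul_const (x := u) v)).ofReal_comp
  simp only [Function.comp_def] at h
  refine h.congr_deriv ?_
  push_cast
  ring

/-- Differentiating j_μ(uv) in v produces u²/(2(μ+1)), exactly the factor that raises the index of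
the weight. -/
theorem hasDerivAt_hankel (hμ : -(1 / 2) < μ) (hf : f ∈ schwartzFunctions) (v : ℝ) :
    HasDerivAt (hankel μ f) (v * -hankel (μ + 1) f v) v := by
  have hμ' : -(1 / 2) < μ + 1 := by linarith
  have hc := fun v => (integrable_hankel hμ hf v).aestronglyMeasurable
  have hi := integrable_hankel hμ' hf v
  have h := (hasDerivAt_integral_of_dominated_loc_of_deriv_le
    (F := fun v u => (normBessel μ (u * v) : ℂ) * (nuDensity μ u : ℂ) * f u)
    (F' := fun v u => -(v * ((normBessel (μ + 1) (u * v) : ℂ) * (nuDensity (μ + 1) u : ℂ) * f u)))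
    (bound := fun u => (|v| + 1) * (2 * ‖(nuDensity (μ + 1) u : ℂ) * f u‖))
    (s := Metric.ball v 1) (Metric.ball_mem_nhds v one_pos) (.of_forall hc)
    (integrable_hankel hμ hf v) (hi.const_mul (v : ℂ)).neg.aestronglyMeasurable
    (.of_forall fun u y hy => ?_)
    ((((polyGrowth_nuDensity hμ').integrable_mul hf).norm.const_mul 2).const_mul _)
    (.of_forall fun u y _ => ?_)).2
  · refine h.congr_deriv ?_
    rw [integral_neg, integral_const_mul, hankel, mul_neg]
  · have hy' : |y| ≤ |v| + 1 := by
      have h1 : |y - v| < 1 := by simpa [Real.dist_eq] using hy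
      have h2 := abs_sub_abs_le_abs_sub y v
      linarith
    rw [norm_neg, norm_mul, mul_assoc, norm_mul _ (_ * f u), Complex.norm_real, Complex.norm_real]
    gcongr
    · exact hy'
    · exact abs_normBessel_le hμ' _
  · have h1 := hasDerivAt_normBessel_comp_mul hμ y u
    simp only [mul_comm _ u] at h1
    refine ((h1.mul_const _).mul_const _).congr_deriv ?_
    rw [nuDensity_add_one hμ]
    push_cast
    ring

/-- This primitive of the Hankel kernel serves the integration by parts in
`hankel_eq_neg_hankel_add_one`; the product rule collapses by the Bessel recurrence. -/
theorem hasDerivAt_mul_nuDensity_mul_normBessel (hμ : -(1 / 2) < μ) (u v : ℝ) :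
    HasDerivAt (fun u => ((u * nuDensity μ u / (2 * (μ + 1)) * normBessel (μ + 1) (u * v) : ℝ) : ℂ))
      ((normBessel μ (u * v) : ℂ) * (nuDensity μ u : ℂ)) u := by
  have h1 : μ + 1 ≠ 0 := by linarith
  have h2 : μ + 2 ≠ 0 := by linarith
  have hj := (hasDerivAt_normBessel (μ := μ + 1) (by linarith) (u * v)).comp u
    (hasDerivAt_mul_const (x := u) v)
  have h := (((hasDerivAt_mul_nuDensity hμ u).div_const (2 * (μ + 1))).mul hj).ofReal_comp
  refine h.congr_deriv ?_
  rw [← Complex.ofReal_mul]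
  congr 1
  rw [normBessel_recurrence hμ, show μ + 1 + 1 = μ + 2 by ring]
  simp only [Function.comp_def]
  field_simp
  ring

theorem hankel_eq_neg_hankel_add_one (hμ : -(1 / 2) < μ) (hf : f ∈ schwartzFunctions)
    (hh : h ∈ schwartzFunctions) (hd : ∀ u : ℝ, HasDerivAt f (u * h u) u) (v : ℝ) :
    hankel μ f v = -hankel (μ + 1) h v := by
  have hμ' : -(1 / 2) < μ + 1 := by linarith
  have e : (fun u : ℝ => ((u * nuDensity μ u / (2 * (μ + 1)) *
      normBessel (μ + 1) (u * v) : ℝ) : ℂ) * (u * h u)) =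
      fun u => (normBessel (μ + 1) (u * v) : ℂ) * (nuDensity (μ + 1) u : ℂ) * h u := by
    ext u
    rw [nuDensity_add_one hμ]
    push_cast
    ring
  have hg : PolyGrowth fun u : ℝ => ((u * nuDensity μ u / (2 * (μ + 1)) *
      normBessel (μ + 1) (u * v) : ℝ) : ℂ) := by
    have := ((polyGrowth_ofReal.mul (polyGrowth_nuDensity hμ)).mul
      (polyGrowth_const (1 / (2 * (μ + 1))))).mul (polyGrowth_normBessel hμ' v)
    convert! this using 2 with u
    push_cast
    ring
  have key := integral_mul_deriv_eq_deriv_mul_of_integrable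
    (fun u _ => hasDerivAt_mul_nuDensity_mul_normBessel hμ u v) (fun u _ => hd u)
    (hg.integrable_mul (schwartz_id_mul hh)) (integrable_hankel hμ hf v) (hg.integrable_mul hf)
  rw [e] at key
  rw [hankel, hankel, key, neg_neg]

/-- Integration by parts in the other direction: the factor v² comes from differentiating j_μ(uv) in
u, and the right side from differentiating u h(u) times the weight. -/
theorem sq_mul_hankel_add_one (hμ : -(1 / 2) < μ) (hh : h ∈ schwartzFunctions)
    (hk : k ∈ schwartzFunctions) (hd : ∀ u : ℝ, HasDerivAt h (u * k u) u) (v : ℝ) :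
    (v : ℂ) ^ 2 * hankel (μ + 1) h v =
      hankel μ (fun u => (2 * μ + 2) * h u + (u : ℂ) ^ 2 * k u) v := by
  have hμ' : -(1 / 2) < μ + 1 := by linarith
  have hm : (fun u => (2 * μ + 2) * h u + (u : ℂ) ^ 2 * k u) ∈ schwartzFunctions :=
    schwartz_add (schwartz_const_mul hh _) (schwartz_pow_mul hk 2)
  have e1 : ∀ u : ℝ, -((u * v ^ 2 / (2 * (μ + 1)) * normBessel (μ + 1) (u * v) : ℝ) : ℂ) *
      (((u * nuDensity μ u : ℝ) : ℂ) * h u) = -((v : ℂ) ^ 2 *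
        ((normBessel (μ + 1) (u * v) : ℂ) * (nuDensity (μ + 1) u : ℂ) * h u)) := by
    intro u
    rw [nuDensity_add_one hμ]
    push_cast
    ring
  have e2 : ∀ u : ℝ, (normBessel μ (u * v) : ℂ) *
      ((((2 * μ + 2) * nuDensity μ u : ℝ) : ℂ) * h u +
        ((u * nuDensity μ u : ℝ) : ℂ) * (u * k u)) =
      (normBessel μ (u * v) : ℂ) * (nuDensity μ u : ℂ) *
        ((2 * μ + 2) * h u + (u : ℂ) ^ 2 * k u) := by
    intro u
    push_cast
    ring
  have hw : ∀ u : ℝ, HasDerivAt (fun u : ℝ => ((u * nuDensity μ u : ℝ) : ℂ) * h u)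
      ((((2 * μ + 2) * nuDensity μ u : ℝ) : ℂ) * h u +
        ((u * nuDensity μ u : ℝ) : ℂ) * (u * k u)) u := fun u =>
    (hasDerivAt_mul_nuDensity hμ u).ofReal_comp.mul (hd u)
  have key := integral_mul_deriv_eq_deriv_mul_of_integrable
    (fun u _ => hasDerivAt_normBessel_comp_mul hμ u v) (fun u _ => hw u)
    ((integrable_hankel hμ hm v).congr (.of_forall fun u => (e2 u).symm))
    (((integrable_hankel hμ' hh v).const_mul _).neg.congr (.of_forall fun u => (e1 u).symm))
    ((integrable_hankel hμ (schwartz_id_mul hh) v).congr (.of_forall fun u => by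
      simp only [Pi.mul_apply]
      push_cast
      ring))
  simp only [e1, e2, integral_neg, neg_neg, integral_const_mul] at key
  exact key.symm

/-- The Bessel recurrence integrated against the weight; f is not differentiated. -/
theorem hankel_sq_mul (hμ : -(1 / 2) < μ) (hf : f ∈ schwartzFunctions) (v : ℝ) :
    hankel μ (fun u => (u : ℂ) ^ 2 * f u) v =
      (2 * μ + 2) * hankel (μ + 1) f v - (v : ℂ) ^ 2 * hankel (μ + 2) f v := by
  have h1 : (μ : ℂ) + 1 ≠ 0 := by
    have : μ + 1 ≠ 0 := by linarith
    exact_mod_cast this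
  have h2 : (μ : ℂ) + 2 ≠ 0 := by
    have : μ + 2 ≠ 0 := by linarith
    exact_mod_cast this
  simp only [hankel, ← integral_const_mul]
  rw [← integral_sub ((integrable_hankel (by linarith) hf v).const_mul _)
    ((integrable_hankel (by linarith) hf v).const_mul _)]
  congr 1 with u
  rw [show μ + 2 = μ + 1 + 1 by ring, nuDensity_add_one (μ := μ + 1) (by linarith),
    nuDensity_add_one hμ, normBessel_recurrence hμ, show μ + 1 + 1 = μ + 2 by ring]
  push_cast
  field_simp
  ring

end Hankel

theorem evenSchwartz_add {f g : ℝ → ℂ} (hf : f ∈ evenSchwartz) (hg : g ∈ evenSchwartz) :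
    (fun x => f x + g x) ∈ evenSchwartz :=
  ⟨schwartz_add hf.1 hg.1, fun x => by simp only [hf.2, hg.2]⟩

theorem evenSchwartz_const_mul {f : ℝ → ℂ} (hf : f ∈ evenSchwartz) (c : ℂ) :
    (fun x => c * f x) ∈ evenSchwartz :=
  ⟨schwartz_const_mul hf.1 c, fun x => by simp only [hf.2]⟩

theorem evenSchwartz_sq_mul {f : ℝ → ℂ} (hf : f ∈ evenSchwartz) :
    (fun x : ℝ => (x : ℂ) ^ 2 * f x) ∈ evenSchwartz :=
  ⟨schwartz_pow_mul hf.1 2, fun x => by simp [hf.2]⟩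

/-- The witness is minus the Bessel operator, -(f'' + (2μ+1) f'/u), written with h = f'/u and k =
h'/u. -/
theorem exists_hankel_eq_sq_mul {μ : ℝ} (hμ : -(1 / 2) < μ) {f : ℝ → ℂ}
    (hf : f ∈ evenSchwartz) :
    ∃ g ∈ evenSchwartz, ∀ v : ℝ, hankel μ g v = (v : ℂ) ^ 2 * hankel μ f v := by
  obtain ⟨h, hh, hd⟩ := exists_evenSchwartz_deriv hf
  obtain ⟨k, hk, hd'⟩ := exists_evenSchwartz_deriv hh
  refine ⟨_, evenSchwartz_const_mul (evenSchwartz_add (evenSchwartz_const_mul hh (2 * μ + 2))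
    (evenSchwartz_sq_mul hk)) (-1), fun v => ?_⟩
  rw [hankel_const_mul, ← sq_mul_hankel_add_one hμ hh.1 hk.1 hd',
    hankel_eq_neg_hankel_add_one hμ hf.1 hh.1 hd]
  ring

theorem hankel_decay {μ : ℝ} (hμ : -(1 / 2) < μ) {f : ℝ → ℂ} (hf : f ∈ evenSchwartz) (n : ℕ) :
    ∃ C, ∀ v, |v| ^ n * ‖hankel μ f v‖ ≤ C := by
  have h2 : ∀ m : ℕ, ∃ C, ∀ v, (v ^ 2) ^ m * ‖hankel μ f v‖ ≤ C := by
    intro m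
    induction m generalizing f with
    | zero => simpa using norm_hankel_le hμ hf.1
    | succ m ih =>
      obtain ⟨g, hg, he⟩ := exists_hankel_eq_sq_mul hμ hf
      obtain ⟨C, hC⟩ := ih hg
      refine ⟨C, fun v => (le_of_eq ?_).trans (hC v)⟩
      rw [he, norm_mul, norm_pow, Complex.norm_real, Real.norm_eq_abs, sq_abs]
      ring
  obtain ⟨C, hC⟩ := h2 0
  obtain ⟨D, hD⟩ := h2 n
  refine ⟨C + D, fun v => ?_⟩
  -- Only powers of v² are available, so t ≤ 1 + t² with t = |v|^n covers the odd ones.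
  have h3 : |v| ^ n ≤ (v ^ 2) ^ 0 + (v ^ 2) ^ n := by
    rw [pow_zero, ← sq_abs v, ← pow_mul, mul_comm 2 n, pow_mul _ n 2]
    nlinarith [sq_nonneg (|v| ^ n - 1)]
  calc _ ≤ ((v ^ 2) ^ 0 + (v ^ 2) ^ n) * ‖hankel μ f v‖ := by gcongr
    _ = (v ^ 2) ^ 0 * ‖hankel μ f v‖ + (v ^ 2) ^ n * ‖hankel μ f v‖ := by ring
    _ ≤ _ := add_le_add (hC v) (hD v)

/-- A variant of `mem_schwartzFunctions_of_family` in which the derivative of a member of the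
family is `x` times a member. -/
theorem mem_schwartzFunctions_of_id_mul_deriv {A : Set (ℝ → ℂ)}
    (hd : ∀ g ∈ A, ∃ h ∈ A, ∀ x : ℝ, HasDerivAt g (x * h x) x)
    (hb : ∀ g ∈ A, ∀ k : ℕ, ∃ C, ∀ x, |x| ^ k * ‖g x‖ ≤ C) : A ⊆ schwartzFunctions := by
  -- The span of the x^m g is closed under differentiation: (x^m g)' = m x^(m-1) g + x^(m+1) h. At m
  -- = 0 the truncated exponent is harmless, its coefficient being 0.
  set B : Set (ℝ → ℂ) := {p | ∃ m : ℕ, ∃ g ∈ A, p = fun x : ℝ => (x : ℂ) ^ m * g x}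
  refine fun g hg => mem_schwartzFunctions_of_family
    (A := (Submodule.span ℂ B : Set (ℝ → ℂ))) (fun p hp => ?_) (fun p hp k => ?_)
    (Submodule.subset_span ⟨0, g, hg, by simp⟩)
  · induction hp using Submodule.span_induction with
    | mem p hp =>
      obtain ⟨m, g, hg, rfl⟩ := hp
      obtain ⟨h, hh, hd⟩ := hd g hg
      refine ⟨(m : ℂ) • (fun x : ℝ => (x : ℂ) ^ (m - 1) * g x) +
        fun x : ℝ => (x : ℂ) ^ (m + 1) * h x, add_mem (Submodule.smul_mem _ _
          (Submodule.subset_span ⟨_, g, hg, rfl⟩)) (Submodule.subset_span ⟨_, h, hh, rfl⟩),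
        fun x => ?_⟩
      refine (((hasDerivAt_id x).ofReal_comp.pow m).mul (hd x)).congr_deriv ?_
      simp [pow_succ]
      ring
    | zero => exact ⟨0, zero_mem _, fun x => hasDerivAt_const x 0⟩
    | add p q _ _ ihp ihq =>
      obtain ⟨p', hp', hdp⟩ := ihp
      obtain ⟨q', hq', hdq⟩ := ihq
      exact ⟨p' + q', add_mem hp' hq', fun x => (hdp x).add (hdq x)⟩
    | smul c p _ ihp =>
      obtain ⟨p', hp', hdp⟩ := ihp
      exact ⟨c • p', Submodule.smul_mem _ c hp', fun x => (hdp x).const_smul c⟩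
  · induction hp using Submodule.span_induction with
    | mem p hp =>
      obtain ⟨m, g, hg, rfl⟩ := hp
      obtain ⟨C, hC⟩ := hb g hg (k + m)
      refine ⟨C, fun x => (le_of_eq ?_).trans (hC x)⟩
      rw [norm_mul, norm_pow, Complex.norm_real, Real.norm_eq_abs]
      ring
    | zero => exact ⟨0, fun x => by simp⟩
    | add p q _ _ ihp ihq =>
      obtain ⟨C, hC⟩ := ihp
      obtain ⟨D, hD⟩ := ihq
      refine ⟨C + D, fun x => le_trans ?_ (add_le_add (hC x) (hD x))⟩
      rw [← mul_add]
      exact mul_le_mul_of_nonneg_left (norm_add_le _ _) (by positivity)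
    | smul c p _ ihp =>
      obtain ⟨C, hC⟩ := ihp
      refine ⟨‖c‖ * C, fun x => ?_⟩
      rw [Pi.smul_apply, norm_smul, mul_left_comm]
      exact mul_le_mul_of_nonneg_left (hC x) (norm_nonneg c)

/-- The closed family must contain all indices, since each derivative raises μ by one. -/
theorem hankel_mem_evenSchwartz {μ : ℝ} (hμ : -(1 / 2) < μ) {f : ℝ → ℂ}
    (hf : f ∈ evenSchwartz) : hankel μ f ∈ evenSchwartz := by
  refine ⟨mem_schwartzFunctions_of_id_mul_deriv
    (A := {g | ∃ μ > -(1 / 2 : ℝ), ∃ f ∈ evenSchwartz, g = hankel μ f}) ?_ ?_ ⟨μ, hμ, f, hf, rfl⟩,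
    hankel_neg_apply⟩
  · rintro _ ⟨μ, hμ, f, hf, rfl⟩
    refine ⟨_, ⟨μ + 1, by linarith, _, evenSchwartz_const_mul hf (-1), rfl⟩, fun v => ?_⟩
    rw [hankel_const_mul, neg_one_mul]
    exact hasDerivAt_hankel hμ hf.1 v
  · rintro _ ⟨μ, hμ, f, hf, rfl⟩ n
    exact hankel_decay hμ hf n

/-! ### The Gaussian and Hankel inversion -/

/-- The Gaussian `exp (-x ^ 2 / 2)`. -/
noncomputable def gauss (x : ℝ) : ℂ := (Real.exp (-(1 / 2) * x ^ 2) : ℝ)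

theorem hasDerivAt_gauss (x : ℝ) : HasDerivAt gauss (x * -gauss x) x := by
  have h := (((hasDerivAt_pow 2 x).const_mul (-(1 / 2) : ℝ)).exp).ofReal_comp
  refine h.congr_deriv ?_
  rw [gauss]
  push_cast
  ring

theorem gauss_mem_evenSchwartz : gauss ∈ evenSchwartz := by
  refine ⟨mem_schwartzFunctions_of_id_mul_deriv (A := {gauss, -gauss}) ?_ ?_
    (Set.mem_insert _ _), fun x => by simp [gauss]⟩
  · rintro _ (rfl | rfl)
    · exact ⟨-gauss, by simp, hasDerivAt_gauss⟩
    · refine ⟨gauss, by simp, fun x => (hasDerivAt_gauss x).neg.congr_deriv (by ring)⟩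
  · have h : ∀ k : ℕ, ∃ C, ∀ x, |x| ^ k * ‖gauss x‖ ≤ C := by
      intro k
      -- From |x|^k ≤ 1 + x^(2k) and the k-th term of the series for exp(x²/2).
      refine ⟨1 + k.factorial * 2 ^ k, fun x => ?_⟩
      have h1 : (x ^ 2 / 2) ^ k / k.factorial ≤ Real.exp (x ^ 2 / 2) :=
        Real.pow_div_factorial_le_exp _ (by positivity) k
      have h2 : ‖gauss x‖ = (Real.exp (x ^ 2 / 2))⁻¹ := by
        rw [gauss, Complex.norm_real, Real.norm_eq_abs, Real.abs_exp, ← Real.exp_neg]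
        ring_nf
      have h3 : |x| ^ k ≤ 1 + (x ^ 2) ^ k := by
        rw [← sq_abs x, ← pow_mul, mul_comm 2 k, pow_mul _ k 2]
        nlinarith [sq_nonneg (|x| ^ k - 1)]
      have h4 : (1 : ℝ) ≤ Real.exp (x ^ 2 / 2) := Real.one_le_exp (by positivity)
      rw [h2, ← div_eq_mul_inv, div_le_iff₀ (Real.exp_pos _)]
      have h5 : (x ^ 2) ^ k ≤ k.factorial * 2 ^ k * Real.exp (x ^ 2 / 2) := by
        rw [div_pow, div_div, div_le_iff₀ (by positivity)] at h1
        linarith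
      linarith
    rintro _ (rfl | rfl)
    · exact h
    · simpa using h

theorem integral_nuDensity_mul_gauss {μ : ℝ} (hμ : -(1 / 2) < μ) :
    ∫ u : ℝ, (nuDensity μ u : ℂ) * gauss u = 1 := by
  have hG : 0 < Real.Gamma (μ + 1) := Real.Gamma_pos_of_pos (by linarith)
  have h1 := integral_comp_abs (f := fun u => u ^ (2 * μ + 1) * Real.exp (-(1 / 2) * u ^ (2 : ℝ)))
  rw [integral_rpow_mul_exp_neg_mul_rpow two_pos (by linarith) (by norm_num)] at h1
  have h2 : (1 / 2 : ℝ) ^ (-(2 * μ + 1 + 1) / 2) = 2 ^ (μ + 1) := by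
    rw [one_div, Real.inv_rpow zero_le_two, ← Real.rpow_neg zero_le_two]
    ring_nf
  rw [h2, show (2 * μ + 1 + 1) / 2 = μ + 1 by ring] at h1
  have h3 : ∀ u : ℝ, (nuDensity μ u : ℂ) * gauss u =
      ((|u| ^ (2 * μ + 1) * Real.exp (-(1 / 2) * |u| ^ (2 : ℝ)) /
        (2 ^ (μ + 1) * Real.Gamma (μ + 1)) : ℝ) : ℂ) := by
    intro u
    rw [nuDensity, gauss, ← Complex.ofReal_mul, Real.rpow_two, sq_abs, div_mul_eq_mul_div]
  simp only [h3]
  rw [integral_complex_ofReal, integral_div, h1]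
  have h4 : (0 : ℝ) < 2 ^ (μ + 1) := by positivity
  norm_cast
  field_simp

/-- As gauss' = -u gauss, raising the index does not change the transform, which therefore solves F'
= -vF, the equation of the Gaussian. The weight is normalized so that F(0) = 1. -/
theorem hankel_gauss {μ : ℝ} (hμ : -(1 / 2) < μ) : hankel μ gauss = gauss := by
  have hg := gauss_mem_evenSchwartz
  have h1 : ∀ v, hankel μ gauss v = hankel (μ + 1) gauss v := fun v => by
    rw [hankel_eq_neg_hankel_add_one hμ hg.1 (evenSchwartz_const_mul hg (-1)).1
      (fun u => by simpa using hasDerivAt_gauss u), hankel_const_mul]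
    ring
  have hd : ∀ v, HasDerivAt (hankel μ gauss) (v * -hankel μ gauss v) v := fun v => by
    simpa only [h1 v] using hasDerivAt_hankel hμ hg.1 v
  have hne : ∀ v, gauss v ≠ 0 := fun v => by simp [gauss, Complex.exp_ne_zero]
  have hq : ∀ v, HasDerivAt (fun v => hankel μ gauss v / gauss v) 0 v := fun v => by
    refine ((hd v).div (hasDerivAt_gauss v) (hne v)).congr_deriv ?_
    rw [div_eq_zero_iff]
    left
    ring
  ext v
  have h2 := is_const_of_deriv_eq_zero (fun v => (hq v).differentiableAt)
    (fun v => (hq v).deriv) v 0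
  have h3 : hankel μ gauss 0 = 1 := by
    simpa [hankel, normBessel_zero hμ] using integral_nuDensity_mul_gauss hμ
  have h4 : gauss 0 = 1 := by simp [gauss]
  simp only [h3, h4, div_one] at h2
  exact (div_eq_one_iff_eq (hne v)).1 h2

/-- By `hankel_sq_mul`, H_μ(u² f) is minus the Bessel operator of H_μ f, with -H_{μ+1} f and H_{μ+2}
f as the successive quotients of derivatives by u. A second H_μ turns that operator into v². -/
theorem hankel_hankel_sq_mul {μ : ℝ} (hμ : -(1 / 2) < μ) {f : ℝ → ℂ} (hf : f ∈ evenSchwartz)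
    (v : ℝ) : hankel μ (hankel μ fun u => (u : ℂ) ^ 2 * f u) v =
      (v : ℂ) ^ 2 * hankel μ (hankel μ f) v := by
  have h1 := evenSchwartz_const_mul (hankel_mem_evenSchwartz (μ := μ + 1) (by linarith) hf) (-1)
  have h2 := hankel_mem_evenSchwartz (μ := μ + 2) (by linarith) hf
  have e : (hankel μ fun u => (u : ℂ) ^ 2 * f u) = fun u : ℝ =>
      -1 * ((2 * μ + 2) * (-1 * hankel (μ + 1) f u) + (u : ℂ) ^ 2 * hankel (μ + 2) f u) := by
    ext u
    rw [hankel_sq_mul hμ hf.1]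
    ring
  rw [e, hankel_const_mul, ← sq_mul_hankel_add_one hμ h1.1 h2.1,
    hankel_eq_neg_hankel_add_one hμ (hankel_mem_evenSchwartz hμ hf).1 h1.1]
  · ring
  · intro u
    simpa using hasDerivAt_hankel hμ hf.1 u
  · intro u
    have h := (hasDerivAt_hankel (μ := μ + 1) (by linarith) hf.1 u).const_mul (-1)
    refine h.congr_deriv ?_
    rw [show μ + 1 + 1 = μ + 2 by ring]
    ring

/-- The Hankel transform is an involution on even Schwartz functions. -/
theorem hankel_hankel {μ : ℝ} (hμ : -(1 / 2) < μ) {f : ℝ → ℂ} (hf : f ∈ evenSchwartz) :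
    hankel μ (hankel μ f) = f := by
  have hadd : ∀ p ∈ evenSchwartz, ∀ q ∈ evenSchwartz, ∀ (c : ℂ) (v : ℝ),
      hankel μ (hankel μ fun u => p u + c * q u) v =
        hankel μ (hankel μ p) v + c * hankel μ (hankel μ q) v := by
    intro p hp q hq c v
    have e : (hankel μ fun u => p u + c * q u) = fun u => hankel μ p u + c * hankel μ q u := by
      ext u
      rw [hankel_add hμ hp.1 (schwartz_const_mul hq.1 c), hankel_const_mul]
    rw [e, hankel_add hμ (hankel_mem_evenSchwartz hμ hp).1
      (schwartz_const_mul (hankel_mem_evenSchwartz hμ hq).1 c), hankel_const_mul]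
  have hg := gauss_mem_evenSchwartz
  ext a
  have hne : gauss a ≠ 0 := by simp [gauss, Complex.exp_ne_zero]
  -- The multiple of the Gaussian matches f at a. Applying H_μ H_μ to (u² - a²) q gives a function
  -- vanishing at a.
  obtain ⟨q, hq, h⟩ := exists_evenSchwartz_eq_sq_sub_mul (a := a)
    (evenSchwartz_add hf (evenSchwartz_const_mul hg (-(f a / gauss a))))
    (by field_simp; ring)
  have e : (fun u => f u + -(f a / gauss a) * gauss u) =
      fun u : ℝ => (u : ℂ) ^ 2 * q u + -(a : ℂ) ^ 2 * q u := by
    ext u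
    rw [h u]
    ring
  have h1 := hadd f hf gauss hg (-(f a / gauss a)) a
  rw [e, hadd _ (evenSchwartz_sq_mul hq) q hq, hankel_hankel_sq_mul hμ hq, hankel_gauss hμ,
    hankel_gauss hμ] at h1
  have h2 : -(f a / gauss a) * gauss a = -f a := by field_simp
  rw [h2] at h1
  linear_combination -h1

/-! ### The non-deformed transform as a pair of Hankel transforms -/

theorem nuDensity_add_natCast {μ : ℝ} (hμ : -(1 / 2) < μ) (n : ℕ) (u : ℝ) :
    nuDensity (μ + n) u =
      u ^ (2 * n) / (2 ^ n * (ascPochhammer ℝ n).eval (μ + 1)) * nuDensity μ u := by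
  induction n with
  | zero => simp
  | succ n ih =>
    have hn : (0 : ℝ) ≤ n := n.cast_nonneg
    have h1 := nuDensity_add_one (μ := μ + n) (by linarith) u
    have h2 : 0 < (ascPochhammer ℝ n).eval (μ + 1) := ascPochhammer_pos n _ (by linarith)
    have h3 : 0 < μ + 1 + n := by linarith
    rw [Nat.cast_succ, ← add_assoc, h1, ih, ascPochhammer_succ_eval,
      show μ + n + 1 = μ + 1 + n by ring]
    field_simp
    ring

theorem oddKernel_mul_nuDensity (lam : ℝ) (r : ℕ) (u v : ℝ) :
    oddKernel r lam (u * v) * (nuDensity lam u : ℂ) =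
      (normBessel lam (u * v) : ℂ) * (nuDensity lam u : ℂ) +
        (Complex.I * (-1) ^ (r + 1) * (v : ℂ) ^ (2 * r + 1) *
          ((1 / (2 ^ (2 * r + 1) * (ascPochhammer ℝ (2 * r + 1)).eval (lam + 1)) : ℝ) : ℂ)) *
        ((u : ℂ) ^ (2 * r + 1) *
          ((normBessel (lam + (2 * r + 1)) (u * v) : ℂ) * (nuDensity lam u : ℂ))) := by
  rw [oddKernel]
  push_cast
  ring

theorem polyGrowth_oddPart {lam : ℝ} (hlam : -(1 / 2) < lam) (r : ℕ) (v : ℝ) :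
    PolyGrowth fun u => (u : ℂ) ^ (2 * r + 1) *
      ((normBessel (lam + (2 * r + 1)) (u * v) : ℂ) * (nuDensity lam u : ℂ)) :=
  (polyGrowth_ofReal_pow _).mul ((polyGrowth_normBessel
    (by have : (0 : ℝ) ≤ r := r.cast_nonneg; linarith) v).mul (polyGrowth_nuDensity hlam))

theorem integrable_nonDeformedTransform {lam : ℝ} (hlam : -(1 / 2) < lam) (r : ℕ) {g : ℝ → ℂ}
    (hg : g ∈ schwartzFunctions) (v : ℝ) :
    Integrable fun u : ℝ => oddKernel r lam (u * v) * g u * (nuDensity lam u : ℂ) := by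
  simp only [mul_right_comm _ (g _), oddKernel_mul_nuDensity, add_mul]
  exact (integrable_hankel hlam hg v).add
    (((polyGrowth_const _).mul (polyGrowth_oddPart hlam r v)).integrable_mul hg)

theorem integral_eq_zero_of_odd {p : ℝ → ℂ} (hp : ∀ u, p (-u) = -p u) : ∫ u, p u = 0 := by
  have h := integral_neg_eq_self p volume
  simp only [hp, integral_neg] at h
  simpa [neg_eq_iff_add_eq_zero] using h

theorem nonDeformedTransform_eq {lam : ℝ} (hlam : -(1 / 2) < lam) (r : ℕ) {f h : ℝ → ℂ}
    (hf : f ∈ evenSchwartz) (hh : h ∈ evenSchwartz) (v : ℝ) :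
    nonDeformedTransform r lam (fun u : ℝ => f u + (u : ℂ) ^ (2 * r + 1) * h u) v =
      hankel lam f v + (v : ℂ) ^ (2 * r + 1) *
        (Complex.I * (-1) ^ (r + 1) * hankel (lam + (2 * r + 1)) h v) := by
  have hr : (0 : ℝ) ≤ r := r.cast_nonneg
  have hlam' : -(1 / 2) < lam + (2 * r + 1) := by linarith
  set n := 2 * r + 1 with hn
  set P : ℝ := 1 / (2 ^ n * (ascPochhammer ℝ n).eval (lam + 1)) with hP
  set c : ℂ := Complex.I * (-1) ^ (r + 1) * (v : ℂ) ^ n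
  set J : ℝ → ℂ := fun u => (normBessel (lam + (2 * r + 1)) (u * v) : ℂ)
  set K : ℝ → ℂ := fun u => (normBessel lam (u * v) : ℂ)
  set N : ℝ → ℂ := fun u => (nuDensity lam u : ℂ)
  -- One u^n comes from the kernel and one from the function; the Pochhammer constant in the kernel
  -- is exactly the one that changes the weight's index.
  have hN : ∀ u : ℝ, (nuDensity (lam + (2 * r + 1)) u : ℂ) = P * (u : ℂ) ^ n * (u : ℂ) ^ n * N u := by
    intro u
    have h1 := nuDensity_add_natCast hlam n u
    rw [hn] at h1
    push_cast at h1
    rw [h1, hP]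
    simp only [N, hn]
    push_cast
    ring
  have hodd : Odd n := odd_two_mul_add_one r
  have i1 := integrable_hankel hlam hf.1 v
  have i2 := (integrable_hankel hlam' hh.1 v).const_mul c
  have i3 : Integrable fun u : ℝ => (K u * N u) * ((u : ℂ) ^ n * h u) :=
    integrable_hankel hlam (schwartz_pow_mul hh.1 n) v
  have i4 : Integrable fun u : ℝ => c * P * ((u : ℂ) ^ n * (J u * N u)) * f u :=
    ((polyGrowth_const _).mul (polyGrowth_oddPart hlam r v)).integrable_mul hf.1
  -- Even products are grouped first, odd cross terms second.
  have e : ∀ u : ℝ, oddKernel r lam (u * v) * (f u + (u : ℂ) ^ n * h u) * N u =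
      (K u * N u * f u + c * (J u * (nuDensity (lam + (2 * r + 1)) u : ℂ) * h u)) +
      ((K u * N u) * ((u : ℂ) ^ n * h u) + c * P * ((u : ℂ) ^ n * (J u * N u)) * f u) := by
    intro u
    rw [mul_right_comm, oddKernel_mul_nuDensity, hN]
    ring
  have hz : ∫ u : ℝ, ((K u * N u) * ((u : ℂ) ^ n * h u) +
      c * P * ((u : ℂ) ^ n * (J u * N u)) * f u) = 0 := by
    refine integral_eq_zero_of_odd fun u => ?_
    simp only [K, J, N, neg_mul u v, normBessel_neg, nuDensity_neg, hf.2, hh.2, Complex.ofReal_neg,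
      hodd.neg_pow]
    ring
  refine (integral_congr_ae (.of_forall e)).trans ((integral_add (i1.add i2) (i3.add i4)).trans
    ((congrArg₂ (· + ·) (integral_add i1 i2) hz).trans ?_))
  rw [add_zero, integral_const_mul, hankel, hankel]
  ring

theorem image_nonDeformedTransform {lam : ℝ} (hlam : -(1 / 2) < lam) (r : ℕ) :
    nonDeformedTransform r lam '' schwartzOddVanishing r = schwartzOddVanishing r := by
  have hr : (0 : ℝ) ≤ r := r.cast_nonneg
  have hlam' : -(1 / 2) < lam + (2 * r + 1) := by linarith
  ext g
  constructor
  · rintro ⟨p, hp, rfl⟩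
    obtain ⟨f, hf, h, hh, rfl⟩ := (mem_schwartzOddVanishing_iff r p).1 hp
    exact (mem_schwartzOddVanishing_iff r _).2 ⟨_, hankel_mem_evenSchwartz hlam hf, _,
      evenSchwartz_const_mul (hankel_mem_evenSchwartz hlam' hh) (Complex.I * (-1) ^ (r + 1)),
      funext fun v => nonDeformedTransform_eq hlam r hf hh v⟩
  · intro hg
    obtain ⟨f, hf, h, hh, rfl⟩ := (mem_schwartzOddVanishing_iff r g).1 hg
    have hf' := hankel_mem_evenSchwartz hlam hf
    have hh' := evenSchwartz_const_mul (hankel_mem_evenSchwartz hlam' hh)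
      (-(Complex.I * (-1) ^ (r + 1)))
    -- The factor i(-1)^(r+1) squares to -1, so the preimage carries its negative, which is its
    -- inverse.
    refine ⟨_, (mem_schwartzOddVanishing_iff r _).2 ⟨_, hf', _, hh', rfl⟩, funext fun v => ?_⟩
    rw [nonDeformedTransform_eq hlam r hf' hh', hankel_const_mul, hankel_hankel hlam hf,
      hankel_hankel hlam' hh]
    have h1 : ((-1 : ℂ) ^ (r + 1)) ^ 2 = 1 := by rw [← pow_mul, mul_comm, pow_mul]; simp
    linear_combination (-(v : ℂ) ^ (2 * r + 1) * h v * ((-1 : ℂ) ^ (r + 1)) ^ 2) * Complex.I_sq +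
      ((v : ℂ) ^ (2 * r + 1) * h v) * h1

theorem mainTheorem3 (lam : ℝ) (hlam : -(1 / 2) < lam) (r : ℕ) :
    -- the integral defining the transform converges absolutely
    (∀ g ∈ schwartzOddVanishing r, ∀ v : ℝ,
      MeasureTheory.Integrable fun u : ℝ =>
        oddKernel r lam (u * v) * g u * (nuDensity lam u : ℂ)) ∧
    -- the transform maps `S_r` onto itself
    nonDeformedTransform r lam '' schwartzOddVanishing r = schwartzOddVanishing r ∧
    -- the case `r = 0` is the Dunkl transform, which maps the Schwartz space onto itself
    (∀ E : ℝ → ℝ → ℂ,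
      IsDunklKernel (lam + 1 / 2) E ↔ E = fun u v => oddKernel 0 lam (u * v)) ∧
    nonDeformedTransform 0 lam '' schwartzFunctions = schwartzFunctions := by
  refine ⟨fun g hg v => integrable_nonDeformedTransform hlam r hg.1 v,
    image_nonDeformedTransform hlam r, isDunklKernel_iff hlam, ?_⟩
  have h := image_nonDeformedTransform hlam 0
  rwa [schwartzOddVanishing_zero] at h
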